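/- Let $K$ be an algebraically closed field of characteristic zero (for instance $K=\mathbb{C}$), let $0<a<r$ be coprime integers, let $\varepsilon\in K$ be a primitive $r$-th root of unity, and let $G=\frac1r(1,a)=\left\langle \begin{pmatrix}\varepsilon&0\\0&\varepsilon^a\end{pmatrix}\right\rangle\le GL(2,K)$, acting on $K[x,y]$ by linear substitution. Write the Jung–Hirzebruch continued fraction $$\frac ra=[\alpha_1,\dots,\alpha_n]=\alpha_1-\cfrac{1}{\alpha_2-\cfrac{1}{\ddots-\cfrac1{\alpha_n}}},\qquad \alpha_i\ge 2 .$$ The reconstruction algebra $A_{r,a}$ is the $K$-algebra defined as follows. Let $Q$ be the quiver with vertices $0,1,\dots,n$ (read modulo $n+1$), one clockwise arrow $c_{i,i-1}\colon i\to i-1$ and one anticlockwise arrow $a_{i,i+1}\colon i\to i+1$ for every vertex $i$, and, for every $1\le i\le n$, $\alpha_i-2$ extra arrows $i\to 0$. The extra arrows are numbered $k_1,\dots,k_N$, $N=\sum_i(\alpha_i-2)$, first those leaving vertex $1$, then those leaving vertex $2$, and so on. In the path algebra $KQ$ the product $pq$ means $p$ followed by $q$. Then $A_{r,a}$ is $KQ$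 modulo the following relations. If $n=1$, let $a_1,a_2$ be the two arrows $0\to1$ and $c_1,c_2$ the two arrows $1\to0$ that are not extra arrows. The relations are $c_2a_1=c_1a_2$, $a_1c_2=a_2c_1$; if $\alpha_1>2$, also $k_1a_1=c_2a_2$, $a_1k_1=a_2c_2$, and $k_ta_1=k_{t-1}a_2$, $a_1k_t=a_2k_{t-1}$ for $2\le t\le\alpha_1-2$. If $n\ge2$, put $k_0=c_{1,0}$ and $k_{N+1}=a_{n,0}$. Let $l_s$ be the tail of $k_s$, $u_i=\max\{j:l_j=i\}$, $v_i=\min\{j:l_j=i\}$, $V_1=0$ and $V_i=\max\{j:l_j<i\}$ for $i\ge2$. For $1\le t\le n$ let $C_{0t}$ be the clockwise path $0\to n\to n-1\to\cdots\to t$ and $A_{0t}$ the anticlockwise path $0\to1\to\cdots\to t$. The relations are, for each $1\le t\le n$: - if $\alpha_t=2$: $c_{t,t-1}a_{t-1,t}=a_{t,t+1}c_{t+1,t}$, and if moreover $t=n$: $c_{0,n}a_{n,0}=A_{0,l_{V_n}}k_{V_n}$; - if $\alpha_t>2$: $k_sA_{0t}=k_{s+1}C_{0t}$ and $A_{0t}k_s=C_{0t}k_{s+1}$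 for $v_t\le s<u_t$; if moreover $t\geq 2$: $c_{t,t-1}a_{t-1,t}=k_{v_t}C_{0t}$ and $C_{0t}k_{v_t}=A_{0,l_{V_t}}k_{V_t}$; if moreover $t<n$: $k_{u_t}A_{0t}=a_{t,t+1}c_{t+1,t}$. Then the centre of $A_{r,a}$ is isomorphic, as a $K$-algebra, to the invariant ring $K[x,y]^{G}=K[x,y]^{\frac1r(1,a)}$, and $A_{r,a}$ is a finitely generated module over its centre. Hence $A_{r,a}$ is a left and right noetherian ring and a PI ring, that is, it satisfies a polynomial identity $f=0$, where $f$ is a polynomial over $\mathbb{Z}$ in non-commuting variables one of whose monomials of highest degree has coefficient $1$. -/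

import Mathlib

open scoped MatrixGroups

noncomputable section

namespace Reconstruction

/-! ### Path algebras of quivers -/

universe u v w

/-- All paths of a quiver, with their start vertex and end vertex. -/
abbrev PathIndex (V : Type v) [Quiver.{w} V] := Σ i j : V, Quiver.Path i j

/-- The path algebra over `K` of a quiver on the vertex set `V`: the vector space with basis the paths.
The product `p * q` of two paths is "`p` followed by `q`", and `0` if they cannot be composed. -/
def PathAlgebra (K : Type u) (V : Type v) [Quiver.{w} V] [CommRing K] := PathIndex V →₀ K

namespace PathAlgebra

variable {K : Type u} {V : Type v} [Quiver.{w} V] [CommRing K]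

instance : AddCommGroup (PathAlgebra K V) := inferInstanceAs (AddCommGroup (PathIndex V →₀ K))

instance : Module K (PathAlgebra K V) := inferInstanceAs (Module K (PathIndex V →₀ K))

/-- The paths form a basis of the path algebra. -/
def basis (K : Type u) (V : Type v) [Quiver.{w} V] [CommRing K] :
    Module.Basis (PathIndex V) K (PathAlgebra K V) :=
  Module.Basis.ofRepr (LinearEquiv.refl K (PathIndex V →₀ K))

/-- The basis element given by a path. -/
def ofPath {i j : V} (p : Quiver.Path i j) : PathAlgebra K V := basis K V ⟨i, j, p⟩

/-- The element given by an arrow. -/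
def ofArrow {i j : V} (e : i ⟶ j) : PathAlgebra K V := ofPath e.toPath

theorem span_induction {P : PathAlgebra K V → Prop} (h0 : P 0)
    (hadd : ∀ f g, P f → P g → P (f + g))
    (hpath : ∀ (c : K) (i j : V) (p : Quiver.Path i j), P (c • ofPath p)) (f : PathAlgebra K V) :
    P f := by
  rw [← (basis K V).linearCombination_repr f, Finsupp.linearCombination_apply, Finsupp.sum]
  exact Finset.sum_induction _ P hadd h0 fun p _ => hpath _ p.1 p.2.1 p.2.2

open Classical in
/-- The product of two basis paths. -/
def mulPath (p q : PathIndex V) : PathAlgebra K V :=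
  if h : q.1 = p.2.1 then ofPath (p.2.2.comp (q.2.2.cast h rfl)) else 0

/-- The bilinear extension of the product of paths. -/
def mulHom : PathAlgebra K V →ₗ[K] PathAlgebra K V →ₗ[K] PathAlgebra K V :=
  (basis K V).constr K fun p => (basis K V).constr K fun q => mulPath p q

instance : Mul (PathAlgebra K V) := ⟨fun f g => mulHom f g⟩

theorem mul_def (f g : PathAlgebra K V) : f * g = mulHom f g := rfl

theorem mulHom_ofPath {i j k l : V} (p : Quiver.Path i j) (q : Quiver.Path k l) :
    mulHom (ofPath (K := K) p) (ofPath q) = mulPath ⟨i, j, p⟩ ⟨k, l, q⟩ := by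
  simp only [mulHom, ofPath, Module.Basis.constr_basis]

theorem ofPath_mul_ofPath {i j k : V} (p : Quiver.Path i j) (q : Quiver.Path j k) :
    (ofPath p * ofPath q : PathAlgebra K V) = ofPath (p.comp q) := by
  rw [mul_def, mulHom_ofPath]
  simp [mulPath]

theorem ofPath_mul_ofPath_of_ne {i j k l : V} (p : Quiver.Path i j) (q : Quiver.Path k l)
    (h : k ≠ j) : (ofPath p * ofPath q : PathAlgebra K V) = 0 := by
  rw [mul_def, mulHom_ofPath]
  simp [mulPath, h]

instance : NonUnitalNonAssocRing (PathAlgebra K V) where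
  left_distrib f g h := by simp [mul_def]
  right_distrib f g h := by simp [mul_def]
  zero_mul f := by simp [mul_def]
  mul_zero f := by simp [mul_def]

protected theorem smul_mul (c : K) (f g : PathAlgebra K V) : c • f * g = c • (f * g) := by
  simp [mul_def]

protected theorem mul_smul (c : K) (f g : PathAlgebra K V) : f * c • g = c • (f * g) := by
  simp [mul_def]

protected theorem mul_assoc (f g h : PathAlgebra K V) : f * g * h = f * (g * h) := by
  induction f using span_induction with
  | h0 => simp only [zero_mul]
  | hadd f f' hf hf' => simp only [add_mul, hf, hf']
  | hpath c i j p =>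
  induction g using span_induction with
  | h0 => simp only [zero_mul, mul_zero]
  | hadd g g' hg hg' => simp only [add_mul, mul_add, hg, hg']
  | hpath d k l q =>
  induction h using span_induction with
  | h0 => simp only [mul_zero]
  | hadd h h' hh hh' => simp only [mul_add, hh, hh']
  | hpath e m n s =>
  simp only [PathAlgebra.smul_mul, PathAlgebra.mul_smul]
  congr 3
  by_cases h1 : k = j
  · subst h1
    by_cases h2 : m = l
    · subst h2
      simp only [ofPath_mul_ofPath, Quiver.Path.comp_assoc]
    · rw [ofPath_mul_ofPath, ofPath_mul_ofPath_of_ne _ _ h2, ofPath_mul_ofPath_of_ne _ _ h2,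
        mul_zero]
  · rw [ofPath_mul_ofPath_of_ne _ _ h1, zero_mul]
    by_cases h2 : m = l
    · subst h2
      rw [ofPath_mul_ofPath, ofPath_mul_ofPath_of_ne _ _ h1]
    · rw [ofPath_mul_ofPath_of_ne _ _ h2, mul_zero]

variable [Fintype V]

/-- The unit is the sum of the trivial paths. -/
instance : One (PathAlgebra K V) := ⟨∑ i : V, ofPath (Quiver.Path.nil : Quiver.Path i i)⟩

theorem one_def : (1 : PathAlgebra K V) = ∑ i : V, ofPath (Quiver.Path.nil : Quiver.Path i i) := rfl

protected theorem one_mul (f : PathAlgebra K V) : 1 * f = f := by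
  induction f using span_induction with
  | h0 => simp only [mul_zero]
  | hadd f g hf hg => rw [mul_add, hf, hg]
  | hpath c i j p =>
    rw [PathAlgebra.mul_smul, one_def, Finset.sum_mul, Finset.sum_eq_single i,
      ofPath_mul_ofPath, Quiver.Path.nil_comp]
    · exact fun k _ hk => ofPath_mul_ofPath_of_ne _ _ hk.symm
    · exact fun h => absurd (Finset.mem_univ i) h

protected theorem mul_one (f : PathAlgebra K V) : f * 1 = f := by
  induction f using span_induction with
  | h0 => simp only [zero_mul]
  | hadd f g hf hg => rw [add_mul, hf, hg]
  | hpath c i j p =>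
    rw [PathAlgebra.smul_mul, one_def, Finset.mul_sum, Finset.sum_eq_single j,
      ofPath_mul_ofPath, Quiver.Path.comp_nil]
    · exact fun k _ hk => ofPath_mul_ofPath_of_ne _ _ hk
    · exact fun h => absurd (Finset.mem_univ j) h

instance : Ring (PathAlgebra K V) :=
  { (inferInstance : NonUnitalNonAssocRing (PathAlgebra K V)),
    (inferInstance : One (PathAlgebra K V)) with
    mul_assoc := PathAlgebra.mul_assoc
    one_mul := PathAlgebra.one_mul
    mul_one := PathAlgebra.mul_one }

instance : Algebra K (PathAlgebra K V) :=
  Algebra.ofModule PathAlgebra.smul_mul fun c f g => PathAlgebra.mul_smul c f g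

end PathAlgebra

/-! ### The quiver of the reconstruction algebra of type `A`

The labels `[α₁, …, αₙ]` are given by a list `L`; the vertices are `0, …, n` (an element of
`Fin (n + 1)`, with arithmetic modulo `n + 1`). -/

/-- The label `αᵢ`, for `1 ≤ i ≤ n`. -/
def label (L : List ℕ) (i : ℕ) : ℕ := L.getD (i - 1) 0

/-- `∑_{1 ≤ j ≤ i} (αⱼ - 2)`: the number of extra arrows leaving the vertices `1, …, i`. -/
def extraCount (L : List ℕ) (i : ℕ) : ℕ := ∑ j ∈ Finset.Icc 1 i, (label L j - 2)

/-- `∑ᵢ (αᵢ - 2)`: the number of all extra arrows. -/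
def extraTotal (L : List ℕ) : ℕ := extraCount L L.length

/-- `l_s`, the number of the tail of the arrow `k_s`, for `0 ≤ s ≤ 1 + ∑ (αᵢ - 2)`. The extra arrows
`k₁, k₂, …` are numbered anticlockwise, so first those leaving vertex `1`, then those leaving
vertex `2`, and so on; `k₀` is the clockwise arrow from `1` to `0` and `k_{1 + ∑ (αᵢ - 2)}` is the
anticlockwise arrow from `n` to `0`. -/
def tail (L : List ℕ) (s : ℕ) : ℕ :=
  if s = 0 then 1
  else if s = extraTotal L + 1 then L.length
  else sInf {i | s ≤ extraCount L i}

/-- `u_i = max {j : l_j = i}`. -/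
def uIdx (L : List ℕ) (i : ℕ) : ℕ := sSup {j | j ≤ extraTotal L + 1 ∧ tail L j = i}

/-- `v_i = min {j : l_j = i}`. -/
def vIdx (L : List ℕ) (i : ℕ) : ℕ := sInf {j | j ≤ extraTotal L + 1 ∧ tail L j = i}

/-- `V_1 = 0` and `V_i = max {j : l_j < i}` for `i ≥ 2`. -/
def VIdx (L : List ℕ) (i : ℕ) : ℕ :=
  if i = 1 then 0 else sSup {j | j ≤ extraTotal L + 1 ∧ tail L j < i}

/-- The vertices `0, …, n`. -/
def Vertex (L : List ℕ) : Type := Fin (L.length + 1)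

namespace Vertex

variable {L : List ℕ}

instance : Fintype (Vertex L) := inferInstanceAs (Fintype (Fin (L.length + 1)))

instance : DecidableEq (Vertex L) := inferInstanceAs (DecidableEq (Fin (L.length + 1)))

/-- The vertex with number `i` modulo `n + 1`. -/
def mk (L : List ℕ) (i : ℕ) : Vertex L := Fin.ofNat (L.length + 1) i

/-- The next vertex in the clockwise direction: `i - 1`, and `n` for `i = 0`. -/
def clNext : Vertex L → Vertex L := fun i : Fin (L.length + 1) => i - 1

/-- The next vertex in the anticlockwise direction: `i + 1`, and `0` for `i = n`. -/
def acNext : Vertex L → Vertex L := fun i : Fin (L.length + 1) => i + 1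

end Vertex

/-- The arrows of the quiver: the double of the extended Dynkin quiver of type `A`, with one
clockwise and one anticlockwise arrow leaving each vertex (so that for `n = 1` there are two arrows
from `0` to `1` and two from `1` to `0`), and the extra arrows `k_s`, `1 ≤ s ≤ ∑ (αᵢ - 2)`, of which
`αᵢ - 2` go from vertex `i` to vertex `0`. -/
inductive Arrow (L : List ℕ) : Vertex L → Vertex L → Type
  | cl (i : Vertex L) : Arrow L i i.clNext
  | ac (i : Vertex L) : Arrow L i i.acNext
  | extra (s : ℕ) (hs : 1 ≤ s ∧ s ≤ extraTotal L) :
      Arrow L (Vertex.mk L (tail L s)) (Vertex.mk L 0)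

instance (L : List ℕ) : Quiver (Vertex L) := ⟨Arrow L⟩

/-! ### The relations -/

section Relations

variable (K : Type u) [CommRing K] (L : List ℕ)

/-- The path algebra of the quiver. -/
abbrev PathAlg : Type u := PathAlgebra K (Vertex L)

/-- The clockwise arrow leaving vertex `i`. -/
def c (i : ℕ) : PathAlg K L := PathAlgebra.ofArrow (Arrow.cl (Vertex.mk L i) : _ ⟶ _)

/-- The anticlockwise arrow leaving vertex `i`. -/
def a (i : ℕ) : PathAlg K L := PathAlgebra.ofArrow (Arrow.ac (Vertex.mk L i) : _ ⟶ _)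

/-- The arrow `k_s` for `0 ≤ s ≤ 1 + ∑ (αᵢ - 2)`, where `k₀` is the clockwise arrow from `1` to `0`
and `k_{1 + ∑ (αᵢ - 2)}` is the anticlockwise arrow from `n` to `0`. -/
def k (s : ℕ) : PathAlg K L :=
  if s = 0 then c K L 1
  else if hs : 1 ≤ s ∧ s ≤ extraTotal L then PathAlgebra.ofArrow (Arrow.extra s hs : _ ⟶ _)
  else a K L L.length

/-- The clockwise path `0 → n → n - 1 → ⋯ → t`, for `1 ≤ t ≤ n`. -/
def C0 (t : ℕ) : PathAlg K L :=
  c K L 0 * ((List.range (L.length - t)).map fun m => c K L (L.length - m)).prod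

/-- The anticlockwise path `0 → 1 → ⋯ → t`, for `1 ≤ t ≤ n`. -/
def A0 (t : ℕ) : PathAlg K L := ((List.range t).map fun m => a K L m).prod

/-- The defining relations of the reconstruction algebra for `n = 1`. The arrows from `0` to `1` are
called `a₁` (clockwise) and `a₂` (anticlockwise), those from `1` to `0` are called `c₁` (clockwise)
and `c₂` (anticlockwise). -/
inductive RelOne : PathAlg K L → PathAlg K L → Prop
  -- c₂ a₁ = c₁ a₂ and a₁ c₂ = a₂ c₁
  | base₁ : RelOne (a K L 1 * c K L 0) (c K L 1 * a K L 0)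
  | base₂ : RelOne (c K L 0 * a K L 1) (a K L 0 * c K L 1)
  -- k₁ a₁ = c₂ a₂ and a₁ k₁ = a₂ c₂ (if there is an arrow k₁)
  | first₁ : 2 < label L 1 → RelOne (k K L 1 * c K L 0) (a K L 1 * a K L 0)
  | first₂ : 2 < label L 1 → RelOne (c K L 0 * k K L 1) (a K L 0 * a K L 1)
  -- k_t a₁ = k_{t-1} a₂ and a₁ k_t = a₂ k_{t-1}
  | next₁ (t : ℕ) : 2 ≤ t → t ≤ label L 1 - 2 →
      RelOne (k K L t * c K L 0) (k K L (t - 1) * a K L 0)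
  | next₂ (t : ℕ) : 2 ≤ t → t ≤ label L 1 - 2 →
      RelOne (c K L 0 * k K L t) (a K L 0 * k K L (t - 1))

/-- The relations of step `t`, `1 ≤ t ≤ n`, for `n ≥ 2`. Here the arrow `c (t + 1)` for `t = n` is the
clockwise arrow leaving vertex `0`. -/
inductive RelStep (t : ℕ) : PathAlg K L → PathAlg K L → Prop
  -- label 2: c_{t,t-1} a_{t-1,t} = a_{t,t+1} c_{t+1,t}, and for t = n also one relation at vertex 0
  | two : label L t = 2 →
      RelStep t (c K L t * a K L (t - 1)) (a K L t * c K L (t + 1))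
  | twoLast : label L t = 2 → t = L.length →
      RelStep t (c K L 0 * a K L t) (A0 K L (tail L (VIdx L t)) * k K L (VIdx L t))
  -- label > 2 and t > 1: relations linking with the preceding steps
  | link₁ : 2 < label L t → 2 ≤ t →
      RelStep t (c K L t * a K L (t - 1)) (k K L (vIdx L t) * C0 K L t)
  | link₂ : 2 < label L t → 2 ≤ t →
      RelStep t (C0 K L t * k K L (vIdx L t)) (A0 K L (tail L (VIdx L t)) * k K L (VIdx L t))
  -- label > 2: relations between consecutive arrows k_s leaving vertex t
  | comm₁ (s : ℕ) : 2 < label L t → vIdx L t ≤ s → s < uIdx L t →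
      RelStep t (k K L s * A0 K L t) (k K L (s + 1) * C0 K L t)
  | comm₂ (s : ℕ) : 2 < label L t → vIdx L t ≤ s → s < uIdx L t →
      RelStep t (A0 K L t * k K L s) (C0 K L t * k K L (s + 1))
  -- label > 2 and t < n: relation linking with the next vertex
  | last : 2 < label L t → t < L.length →
      RelStep t (k K L (uIdx L t) * A0 K L t) (a K L t * c K L (t + 1))

/-- All defining relations of the reconstruction algebra. -/
inductive Rel : PathAlg K L → PathAlg K L → Prop
  | one {p q : PathAlg K L} : L.length = 1 → RelOne K L p q → Rel p q
  | step {p q : PathAlg K L} (t : ℕ) : 2 ≤ L.length → 1 ≤ t → t ≤ L.length →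
      RelStep K L t p q → Rel p q

/-- The reconstruction algebra of type `A` with labels `L = [α₁, …, αₙ]`: the path algebra of the
quiver modulo the two-sided ideal generated by the relations. -/
abbrev ReconstructionAlgebra : Type u := RingQuot (Rel K L)

end Relations

/-! ### The algebra `A_{r,a}` -/

/-- The Jung-Hirzebruch continued fraction expansion of `r / a`: the first entry is `α = ⌈r / a⌉`, and
if `α a > r` it is followed by the expansion of `a / (α a - r)`. -/
def jungHirzebruch (r a : ℕ) : List ℕ :=
  if _h : a = 0 then []
  else (r ⌈/⌉ a) :: jungHirzebruch a ((r ⌈/⌉ a) * a - r)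
termination_by a
decreasing_by
  have := Nat.div_mul_le_self (r + a - 1) a
  rw [Nat.ceilDiv_eq_add_pred_div]
  omega

/-- The value `[α₁, …, αₙ] = α₁ - 1 / (α₂ - 1 / (⋯))`, where `[αₙ] = αₙ - 1 / 0 = αₙ`. -/
def continuedFraction : List ℕ → ℚ
  | [] => 0
  | α :: L => α - 1 / continuedFraction L

theorem continuedFraction_jungHirzebruch (r a : ℕ) :
    continuedFraction (jungHirzebruch r a) = r / a := by
  induction a using Nat.strong_induction_on generalizing r with
  | _ a ih =>
    rw [jungHirzebruch]
    split_ifs with h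
    · simp [continuedFraction, h]
    · have h1 := Nat.div_mul_le_self (r + a - 1) a
      have h2 : r ≤ (r ⌈/⌉ a) * a := by
        have := le_smul_ceilDiv (b := r) (Nat.pos_of_ne_zero h)
        rwa [smul_eq_mul, mul_comm] at this
      have h3 : (r ⌈/⌉ a) * a - r < a := by
        rw [Nat.ceilDiv_eq_add_pred_div]
        omega
      have ha : (a : ℚ) ≠ 0 := by exact_mod_cast h
      rw [continuedFraction, ih _ h3, one_div_div, Nat.cast_sub h2, Nat.cast_mul]
      field_simp
      ring

theorem two_le_of_mem_jungHirzebruch {r a : ℕ} (h : a < r) :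
    ∀ m ∈ jungHirzebruch r a, 2 ≤ m := by
  induction a using Nat.strong_induction_on generalizing r with
  | _ a ih =>
    rw [jungHirzebruch]
    split_ifs with h0
    · simp
    · have h1 := Nat.div_mul_le_self (r + a - 1) a
      have h3 : (r ⌈/⌉ a) * a - r < a := by
        rw [Nat.ceilDiv_eq_add_pred_div]
        omega
      intro m hm
      rcases List.mem_cons.1 hm with rfl | hm
      · rw [Nat.ceilDiv_eq_add_pred_div, Nat.le_div_iff_mul_le (Nat.pos_of_ne_zero h0)]
        omega
      · exact ih _ h3 h3 m hm

/-- The reconstruction algebra `A_{r,a}`. -/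
abbrev A (K : Type u) [CommRing K] (r a : ℕ) : Type u :=
  ReconstructionAlgebra K (jungHirzebruch r a)

/-! ### The invariant ring -/

/-- The group `1/r (1, a)`, generated by `ζ = diag (ε, ε ^ a)`, where `ε` is a primitive `r`-th root
of unity. -/
def cyclicGroup {K : Type u} [Field K] (ε : Kˣ) (a : ℕ) : Subgroup (GL (Fin 2) K) :=
  Subgroup.zpowers (Units.map (Matrix.diagonalRingHom (Fin 2) K).toMonoidHom
    (MulEquiv.piUnits.symm ![ε, ε ^ a]))

/-- The action of an invertible matrix `g` on `K[x, y]` by `g • x_j = ∑ i, g i j * x_i`, where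
`x_0 = x` and `x_1 = y`. -/
def linearSubst {K : Type u} [Field K] (g : GL (Fin 2) K) :
    MvPolynomial (Fin 2) K →ₐ[K] MvPolynomial (Fin 2) K :=
  MvPolynomial.aeval fun j => ∑ i, MvPolynomial.C (g.1 i j) * MvPolynomial.X i

/-- The invariant ring `K[x, y] ^ G`. -/
def invariantRing {K : Type u} [Field K] (G : Subgroup (GL (Fin 2) K)) :
    Subalgebra K (MvPolynomial (Fin 2) K) :=
  ⨅ g : G, AlgHom.equalizer (linearSubst g.1) (AlgHom.id K _)

/-! ### Polynomial identities -/

/-- A ring `R` is a PI ring if it satisfies a monic polynomial identity: there is a polynomial `f`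
over `ℤ` in non-commuting variables, such that some monomial of highest degree in `f` has
coefficient `1`, and that vanishes under every substitution of elements of `R`. -/
def IsPIRing (R : Type u) [Ring R] : Prop :=
  ∃ f : MonoidAlgebra ℤ (FreeMonoid ℕ),
    (∃ m : FreeMonoid ℕ, f.coeff m = 1 ∧ ∀ m' : FreeMonoid ℕ, f.coeff m' ≠ 0 → m'.length ≤ m.length) ∧
    ∀ φ : ℕ → R, MonoidAlgebra.lift ℤ R (FreeMonoid ℕ) (FreeMonoid.lift φ) f = 0

end Reconstruction

end

/-! The algebra is a graded algebra of matrices in disguise. Let `I` be the `i`-series `r, a, …, 0`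
and `J` the `j`-series `0, 1, …`; both obey the linear recurrence whose coefficients are the labels.
Give the clockwise arrow `t + 1 → t` the degree `x ^ (I t - I (t + 1))`, the anticlockwise arrow `t
→ t + 1` the degree `y ^ (J (t + 1) - J t)`, and `k_s` the degree `x ^ X s * y ^ Y s`. Then `C_{0t}`
has degree `x ^ I t`, `A_{0t}` has degree `y ^ J t`, and all relations are homogeneous. Placing the
degree of a path from `i` to `j` at the entry `(i, j)` therefore defines a homomorphism `toMatrix`
to matrices over `K[x, y]`.

Uniqueness: in the algebra, two paths with the same ends and the same degree are equal
(`Word.unique`), so `toMatrix` is injective. The point is that a path with enough `x`-degree can be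
rewritten so as to begin with the clockwise arrow at its start (`Word.factorsBelow`). Two such paths
are compared by removing this arrow. Otherwise a path is trivial or begins with an anticlockwise
arrow or some `k_s`, and the relations between neighbouring arrows settle these cases. All
inductions run over the total degree, which the relations preserve, unlike the length.

Existence: every monomial `x ^ u * y ^ v` with `r ∣ u + a * v` is the degree of a cycle at every
vertex (`Word.exists_cycle`). The elementary cycles at `0` have degrees cutting the quadrant into
cones, and each pair of neighbours has determinant `r`, hence is a basis of the lattice of invariant
exponents.

The trivial paths and the paths `A_{0i}` force a central element to become a scalar matrix. Its
entry is invariant because degrees of cycles are invariant, and every invariant occurs by existence.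
So the centre is the invariant ring. The ring `K[x, y]` is finite over its invariants, which are
noetherian, so the algebra is a submodule of a noetherian module over its centre. As a subring of a
matrix ring over a commutative domain, it satisfies a standard identity. -/

noncomputable section

namespace Reconstruction

universe u

/-! ### The numerical data of a reconstruction algebra -/

/-- The numbers attached to a Jung-Hirzebruch continued fraction: `I` and `J` are the `i`-series and
the `j`-series, `E t` is the number of extra arrows leaving the vertices `1, …, t`, and `l s` is the
tail of the `s`-th arrow. -/
structure Ladder where
  n : ℕ
  N : ℕ
  E : ℕ → ℕ
  l : ℕ → ℕ
  I : ℕ → ℤ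
  J : ℕ → ℤ
  one_le_n : 1 ≤ n
  E_zero : E 0 = 0
  E_n : E n = N
  E_succ : ∀ t, E t ≤ E (t + 1)
  l_zero : l 0 = 1
  l_last : l (N + 1) = n
  l_spec : ∀ s, 1 ≤ s → s ≤ N → ∃ t < n, l s = t + 1 ∧ E t < s ∧ s ≤ E (t + 1)
  I_lt : ∀ t ≤ n, I (t + 1) < I t
  I_last : I (n + 1) = 0
  -- The coefficient is the label of vertex `t + 1`, because `E (t + 1) - E t` counts its extra
  -- arrows.
  I_rec : ∀ t < n, I (t + 2) = ((E (t + 1) : ℤ) - E t + 2) * I (t + 1) - I t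
  J_zero : J 0 = 0
  J_one : J 1 = 1
  J_rec : ∀ t < n, J (t + 2) = ((E (t + 1) : ℤ) - E t + 2) * J (t + 1) - J t

namespace Ladder

variable (D : Ladder)

/-- The `x`-degree of the arrow `k_s`. -/
def X (s : ℕ) : ℤ := D.I (D.l s - 1) - ((s : ℤ) - D.E (D.l s - 1) + 1) * D.I (D.l s)

/-- The `y`-degree of the arrow `k_s`. -/
def Y (s : ℕ) : ℤ := ((s : ℤ) - D.E (D.l s - 1)) * D.J (D.l s) - D.J (D.l s - 1)

/-! ### Tails of the arrows, and inequalities and congruences for their degrees -/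

theorem E_mono : Monotone D.E := monotone_nat_of_le_succ D.E_succ

/-- Treats `k_0` and `k_{N+1}` together with the extra arrows. These two lie just outside the
intervals `E t < s ≤ E (t + 1)`, so each bound is weakened by one and is sharp away from the
exceptional index. -/
theorem l_bounds {s : ℕ} (hs : s ≤ D.N + 1) :
    ∃ t < D.n, D.l s = t + 1 ∧ D.E t ≤ s ∧ s ≤ D.E (t + 1) + 1 ∧ (s = 0 → t = 0) ∧
      (s ≠ 0 → D.E t < s) ∧ (s = D.N + 1 → t + 1 = D.n) ∧ (s ≠ D.N + 1 → s ≤ D.E (t + 1)) := by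
  have hn := D.one_le_n
  rcases Nat.eq_zero_or_pos s with rfl | h0
  · exact ⟨0, by omega, by simp [D.l_zero], by simp [D.E_zero], by omega, by simp, by simp,
      by omega, by omega⟩
  rcases Nat.lt_or_ge D.N s with h1 | h1
  · obtain rfl : s = D.N + 1 := by omega
    have hE : D.E (D.n - 1) ≤ D.E D.n := D.E_mono (by omega)
    have h2 := D.E_n
    refine ⟨D.n - 1, by omega, by rw [D.l_last]; omega, by omega, ?_, by omega, by omega, by omega,
      by omega⟩
    rw [Nat.sub_add_cancel hn]; omega
  · obtain ⟨t, ht, h3, h4, h5⟩ := D.l_spec s h0 h1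
    exact ⟨t, ht, h3, by omega, by omega, by omega, by omega, by omega, by omega⟩

theorem l_unique {s t : ℕ} (h1 : D.E t < s) (h2 : s ≤ D.E (t + 1)) (h3 : s ≤ D.N) :
    D.l s = t + 1 := by
  obtain ⟨t', -, h4, h5, h6⟩ := D.l_spec s (by omega) h3
  rw [h4]
  rcases lt_trichotomy t t' with h | h | h
  · have := D.E_mono (show t + 1 ≤ t' by omega); omega
  · rw [h]
  · have := D.E_mono (show t' + 1 ≤ t by omega); omega

theorem X_eq {s t : ℕ} (h : D.l s = t + 1) :
    D.X s = D.I t - ((s : ℤ) - D.E t + 1) * D.I (t + 1) := by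
  simp [X, h]

theorem Y_eq {s t : ℕ} (h : D.l s = t + 1) :
    D.Y s = ((s : ℤ) - D.E t) * D.J (t + 1) - D.J t := by
  simp [Y, h]

theorem I_nonneg : ∀ {t : ℕ}, t ≤ D.n + 1 → 0 ≤ D.I t := by
  suffices h : ∀ d, d ≤ D.n + 1 → 0 ≤ D.I (D.n + 1 - d) by
    intro t ht
    have := h (D.n + 1 - t) (by omega)
    rwa [show D.n + 1 - (D.n + 1 - t) = t by omega] at this
  intro d
  induction d with
  | zero => intro _; simp [D.I_last]
  | succ d ih =>
    intro hd
    have h1 := ih (by omega)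
    have h2 := D.I_lt (D.n + 1 - (d + 1)) (by omega)
    rw [show D.n + 1 - (d + 1) + 1 = D.n + 1 - d by omega] at h2
    omega

theorem I_pos {t : ℕ} (ht : t ≤ D.n) : 0 < D.I t :=
  (D.I_nonneg (by omega)).trans_lt (D.I_lt t ht)

theorem J_lt_and_nonneg : ∀ {t : ℕ}, t ≤ D.n → D.J t < D.J (t + 1) ∧ 0 ≤ D.J t := by
  intro t
  induction t with
  | zero => intro _; simp [D.J_zero, D.J_one]
  | succ t ih =>
    intro ht
    obtain ⟨h1, h2⟩ := ih (by omega)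
    refine ⟨?_, by omega⟩
    have h3 := D.J_rec t (by omega)
    have h4 : (D.E t : ℤ) ≤ D.E (t + 1) := by exact_mod_cast D.E_succ t
    rw [h3]
    nlinarith

theorem J_lt {t : ℕ} (ht : t ≤ D.n) : D.J t < D.J (t + 1) := (D.J_lt_and_nonneg ht).1

theorem J_nonneg {t : ℕ} (ht : t ≤ D.n) : 0 ≤ D.J t := (D.J_lt_and_nonneg ht).2

theorem J_pos {t : ℕ} (ht : t ≤ D.n) : 0 < D.J (t + 1) :=
  (D.J_nonneg ht).trans_lt (D.J_lt ht)

/-- Labels are at least `2`. In terms of degrees, the clockwise arrow at the next vertex asks for no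
more `x`-degree than the one at the present vertex. -/
theorem I_convex {t : ℕ} (ht : t < D.n) : D.I (t + 1) - D.I (t + 2) ≤ D.I t - D.I (t + 1) := by
  have h3 := D.I_rec t ht
  have h4 : (D.E t : ℤ) ≤ D.E (t + 1) := by exact_mod_cast D.E_succ t
  have h5 := D.I_pos (t := t + 1) (by omega)
  rw [h3]
  nlinarith

theorem X_last : D.X (D.N + 1) = 0 := by
  obtain ⟨t, ht, h1, -, -, -, -, h2, -⟩ := D.l_bounds (s := D.N + 1) le_rfl
  have h3 := h2 rfl
  have h4 := D.I_rec t ht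
  rw [D.X_eq h1]
  rw [show t + 2 = D.n + 1 by omega, D.I_last, h3, D.E_n] at h4
  rw [h3]
  push_cast
  linarith

theorem Y_last : D.Y (D.N + 1) + D.J D.n = D.J (D.n + 1) := by
  obtain ⟨t, ht, h1, -, -, -, -, h2, -⟩ := D.l_bounds (s := D.N + 1) le_rfl
  have h3 := h2 rfl
  have h4 := D.J_rec t ht
  rw [D.Y_eq h1]
  rw [show t + 2 = D.n + 1 by omega, h3, D.E_n] at h4
  rw [h3]
  push_cast
  linarith

theorem X_zero : D.X 0 = D.I 0 - D.I 1 := by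
  simp [D.X_eq (s := 0) (t := 0) (by simp [D.l_zero]), D.E_zero]

theorem Y_zero : D.Y 0 = 0 := by
  simp [D.Y_eq (s := 0) (t := 0) (by simp [D.l_zero]), D.E_zero, D.J_zero]

theorem X_pos {s : ℕ} (hs : s ≤ D.N) : 0 < D.X s := by
  obtain ⟨t, ht, h1, -, -, -, -, -, h2⟩ := D.l_bounds (s := s) (by omega)
  have h3 := h2 (by omega)
  rw [D.X_eq h1]
  have h4 := D.I_rec t ht
  have h5 := D.I_lt (t + 1) (by omega)
  have h6 := D.I_pos (t := t + 1) (by omega)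
  have h7 : (s : ℤ) ≤ D.E (t + 1) := by exact_mod_cast h3
  have h8 : D.I (t + 2) < D.I (t + 1) := h5
  nlinarith

theorem X_nonneg {s : ℕ} (hs : s ≤ D.N + 1) : 0 ≤ D.X s := by
  rcases Nat.lt_or_ge D.N s with h | h
  · obtain rfl : s = D.N + 1 := by omega
    rw [X_last]
  · exact (D.X_pos h).le

theorem Y_pos {s : ℕ} (hs : s ≤ D.N + 1) (h0 : s ≠ 0) : 0 < D.Y s := by
  obtain ⟨t, ht, h1, -, -, -, h2, -, -⟩ := D.l_bounds hs
  have h3 : (D.E t : ℤ) + 1 ≤ s := by exact_mod_cast h2 h0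
  have h4 := D.J_lt (t := t) (by omega)
  have h5 := D.J_pos (t := t) (by omega)
  rw [D.Y_eq h1]
  nlinarith

theorem Y_nonneg {s : ℕ} (hs : s ≤ D.N + 1) : 0 ≤ D.Y s := by
  rcases Nat.eq_zero_or_pos s with rfl | h
  · rw [Y_zero]
  · exact (D.Y_pos hs (by omega)).le

theorem X_add_Y_pos {s : ℕ} (hs : s ≤ D.N + 1) : 0 < D.X s + D.Y s := by
  rcases Nat.lt_or_ge D.N s with h | h
  · exact add_pos_of_nonneg_of_pos (D.X_nonneg hs) (D.Y_pos hs (by omega))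
  · exact add_pos_of_pos_of_nonneg (D.X_pos h) (D.Y_nonneg hs)

theorem X_succ {s : ℕ} (h : D.l (s + 1) = D.l s) : D.X s = D.X (s + 1) + D.I (D.l s) := by
  simp only [X, h]; push_cast; ring

theorem Y_succ {s : ℕ} (h : D.l (s + 1) = D.l s) : D.Y (s + 1) = D.Y s + D.J (D.l s) := by
  simp only [Y, h]; push_cast; ring

/-- If `k_{s+1}` is the first arrow leaving its vertex, then all extra arrows up to `k_s` leave
smaller vertices. -/
theorem l_first {s : ℕ} (hs : s ≤ D.N) (h : D.l (s + 1) ≠ D.l s) :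
    ∃ t, 1 ≤ t ∧ t < D.n ∧ D.l (s + 1) = t + 1 ∧ s = D.E t := by
  obtain ⟨t, ht, h1, h2, h3, h4, h5, h6, h7⟩ := D.l_bounds (s := s + 1) (by omega)
  have h8 := h5 (by omega)
  have hE : s = D.E t := by
    by_contra hne
    have : D.l s = t + 1 := by
      refine D.l_unique (by omega) ?_ hs
      by_cases hN : s + 1 = D.N + 1
      · rw [h6 hN, D.E_n]; omega
      · have := h7 hN; omega
    exact h (by rw [h1, this])
  refine ⟨t, ?_, ht, h1, hE⟩
  by_contra h0
  obtain rfl : t = 0 := by omega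
  rw [D.E_zero] at hE
  subst hE
  exact h (by rw [h1, D.l_zero])

theorem l_lastOf {s : ℕ} (hs : s ≤ D.N) (h : D.l (s + 1) ≠ D.l s) :
    ∃ t, t + 1 < D.n ∧ D.l s = t + 1 ∧ s = D.E (t + 1) := by
  obtain ⟨t, ht, h1, h2, h3, h4, h5, h6, h7⟩ := D.l_bounds (s := s) (by omega)
  have h8 := h7 (by omega)
  have hE : s = D.E (t + 1) := by
    by_contra hne
    have : D.l (s + 1) = t + 1 := by
      refine D.l_unique (by omega) (by omega) ?_
      have := D.E_mono (show t + 1 ≤ D.n by omega)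
      rw [D.E_n] at this
      omega
    exact h (by rw [h1, this])
  refine ⟨t, ?_, h1, hE⟩
  by_contra h0
  obtain hn : t + 1 = D.n := by omega
  rw [hn, D.E_n] at hE
  rw [hE, D.l_last] at h
  rw [hE, hn] at h1
  exact h h1.symm

theorem X_first {s t : ℕ} (hs : s ≤ D.N) (h : D.l (s + 1) ≠ D.l s) (ht : D.l (s + 1) = t + 1) :
    D.X (s + 1) + D.I (t + 1) = D.I t - D.I (t + 1) := by
  obtain ⟨t', -, -, h1, h2⟩ := D.l_first hs h
  obtain rfl : t = t' := by omega
  rw [D.X_eq h1, h2]; push_cast; ring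

theorem Y_first {s t : ℕ} (hs : s ≤ D.N) (h : D.l (s + 1) ≠ D.l s) (ht : D.l (s + 1) = t + 1) :
    D.Y (s + 1) = D.J (t + 1) - D.J t := by
  obtain ⟨t', -, -, h1, h2⟩ := D.l_first hs h
  obtain rfl : t = t' := by omega
  rw [D.Y_eq h1, h2]; push_cast; ring

theorem X_lastOf {s t : ℕ} (hs : s ≤ D.N) (h : D.l (s + 1) ≠ D.l s) (ht : D.l s = t + 1) :
    D.X s = D.I (t + 1) - D.I (t + 2) := by
  obtain ⟨t', h0, h1, h2⟩ := D.l_lastOf hs h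
  obtain rfl : t = t' := by omega
  rw [D.X_eq h1, h2, D.I_rec t (by omega)]; ring

theorem Y_lastOf {s t : ℕ} (hs : s ≤ D.N) (h : D.l (s + 1) ≠ D.l s) (ht : D.l s = t + 1) :
    D.Y s + D.J (t + 1) = D.J (t + 2) - D.J (t + 1) := by
  obtain ⟨t', h0, h1, h2⟩ := D.l_lastOf hs h
  obtain rfl : t = t' := by omega
  rw [D.Y_eq h1, h2, D.J_rec t (by omega)]; ring

/-- A vertex `t < n` without arrows `k_s` has label `2`. -/
theorem exists_lastOf_or (t : ℕ) (ht : t + 1 < D.n) :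
    (∃ s ≤ D.N, D.l s = t + 1 ∧ D.l (s + 1) ≠ D.l s) ∨ (1 ≤ t ∧ D.E (t + 1) = D.E t) := by
  have hN := D.E_mono (show t + 1 ≤ D.n by omega)
  rw [D.E_n] at hN
  have key : ∀ s, s ≤ D.N → s = D.E (t + 1) → D.l s = t + 1 →
      ∃ s ≤ D.N, D.l s = t + 1 ∧ D.l (s + 1) ≠ D.l s := by
    intro s hs h1 h2
    refine ⟨s, hs, h2, fun h => ?_⟩
    obtain ⟨t', -, h3, -, -, -, -, h6, h7⟩ := D.l_bounds (s := s + 1) (by omega)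
    obtain rfl : t' = t := by omega
    by_cases h8 : s + 1 = D.N + 1
    · have := h6 h8; omega
    · have := h7 h8; omega
  rcases (D.E_succ t).lt_or_eq with h | h
  · exact Or.inl (key _ hN rfl (D.l_unique h le_rfl hN))
  · rcases Nat.eq_zero_or_pos t with rfl | h0
    · rw [D.E_zero] at h
      exact Or.inl (key 0 (by omega) h D.l_zero)
    · exact Or.inr ⟨h0, h.symm⟩

/-- Between the tails of two consecutive arrows `k_s`, `k_{s+1}` all labels are `2`. -/
theorem l_gap {s : ℕ} (hs : s ≤ D.N) (h : D.l (s + 1) ≠ D.l s) :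
    ∃ t t', t ≤ t' ∧ t' + 1 < D.n ∧ D.l s = t + 1 ∧ D.l (s + 1) = t' + 2 ∧
      ∀ d, t + 1 ≤ d → d ≤ t' → D.E (d + 1) = D.E d := by
  obtain ⟨t, h0, h1, h2⟩ := D.l_lastOf hs h
  obtain ⟨t', h0', h1', h2', h3'⟩ := D.l_first hs h
  obtain ⟨t', rfl⟩ : ∃ t'', t' = t'' + 1 := ⟨t' - 1, by omega⟩
  refine ⟨t, t', ?_, h1', h1, h2', fun d hd hd' => ?_⟩
  · by_contra hlt
    rcases (show t' + 1 ≤ t by omega).lt_or_eq with h4 | h4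
    · rcases Nat.eq_zero_or_pos s with h5 | h5
      · rw [h5, D.l_zero] at h1; omega
      · obtain ⟨w, -, h6, h7, -⟩ := D.l_spec s h5 hs
        have := D.E_mono (show t' + 1 ≤ w by omega)
        omega
    · exact h (by omega)
  · have h6 := D.E_mono hd
    have h7 := D.E_mono (show d ≤ d + 1 by omega)
    have h8 := D.E_mono (show d + 1 ≤ t' + 1 by omega)
    omega

/-- Where the label is `2` the recurrence says that the second difference vanishes, so both series
are arithmetic progressions across a gap without arrows `k_s`. -/
theorem sub_eq_of_gap {F : ℕ → ℤ}
    (hF : ∀ t < D.n, F (t + 2) = ((D.E (t + 1) : ℤ) - D.E t + 2) * F (t + 1) - F t) {t t' : ℕ}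
    (htt' : t ≤ t') (ht' : t' + 1 < D.n) (hE : ∀ d, t + 1 ≤ d → d ≤ t' → D.E (d + 1) = D.E d) :
    F (t + 1) - F (t + 2) = F (t' + 1) - F (t' + 2) := by
  induction t', htt' using Nat.le_induction with
  | base => rfl
  | succ t' h ih =>
    rw [ih (by omega) fun d hd hd' => hE d hd (by omega), hF (t' + 1) (by omega),
      hE (t' + 1) (by omega) le_rfl]
    ring

/-- The degree of `A_{0 l_s} k_s` is that of `C_{0 l_{s+1}} k_{s+1}`. -/
theorem X_eq_X_succ_add {s : ℕ} (hs : s ≤ D.N) : D.X s = D.X (s + 1) + D.I (D.l (s + 1)) := by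
  by_cases h : D.l (s + 1) = D.l s
  · rw [D.X_succ h, h]
  · obtain ⟨t, t', h1, h2, h3, h4, h5⟩ := D.l_gap hs h
    rw [h4, D.X_first hs h h4, D.X_lastOf hs h h3, D.sub_eq_of_gap D.I_rec h1 h2 h5]

theorem Y_succ_eq {s : ℕ} (hs : s ≤ D.N) : D.Y (s + 1) = D.Y s + D.J (D.l s) := by
  by_cases h : D.l (s + 1) = D.l s
  · exact D.Y_succ h
  · obtain ⟨t, t', h1, h2, h3, h4, h5⟩ := D.l_gap hs h
    have := D.sub_eq_of_gap D.J_rec h1 h2 h5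
    rw [h3, D.Y_first hs h h4, D.Y_lastOf hs h h3]
    linarith

/-- The two series satisfy the same recurrence, so their Casorati determinant is constant. -/
theorem I_mul_J_sub {t : ℕ} (ht : t ≤ D.n) :
    D.I t * D.J (t + 1) - D.I (t + 1) * D.J t = D.I 0 := by
  induction t with
  | zero => simp [D.J_zero, D.J_one]
  | succ t ih =>
    rw [← ih (by omega), D.I_rec t (by omega), D.J_rec t (by omega)]
    ring

/-- The determinant of the degrees of two neighbouring generators of the invariant ring. -/
theorem det_eq {s : ℕ} (hs : s ≤ D.N + 1) :
    (D.X s + D.I (D.l s)) * (D.Y s + D.J (D.l s)) - D.X s * D.Y s = D.I 0 := by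
  obtain ⟨t, ht, h, -⟩ := D.l_bounds hs
  rw [D.X_eq h, D.Y_eq h, h, ← D.I_mul_J_sub (t := t) (by omega)]
  ring

/-- Modulo `I 0`, the sequences `I` and `I 1 * J` agree at `0` and `1` and satisfy the same
recurrence. -/
theorem dvd_I_sub (t : ℕ) (ht : t ≤ D.n + 1) : D.I 0 ∣ D.I t - D.I 1 * D.J t := by
  induction t using Nat.strong_induction_on with
  | _ t ih =>
    match t with
    | 0 => simp [D.J_zero]
    | 1 => simp [D.J_one]
    | t + 2 =>
      have h1 := ih t (by omega) (by omega)
      have h2 := ih (t + 1) (by omega) (by omega)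
      rw [D.I_rec t (by omega), D.J_rec t (by omega)]
      exact (dvd_sub (h2.mul_left ((D.E (t + 1) : ℤ) - D.E t + 2)) h1).trans
        (dvd_of_eq (by ring))

theorem dvd_X_add {s : ℕ} (hs : s ≤ D.N + 1) :
    D.I 0 ∣ D.X s + D.I 1 * D.Y s + D.I (D.l s) := by
  obtain ⟨t, ht, h, -⟩ := D.l_bounds hs
  have h1 := D.dvd_I_sub t (by omega)
  have h2 := D.dvd_I_sub (t + 1) (by omega)
  rw [D.X_eq h, D.Y_eq h, h]
  exact (dvd_sub h1 (h2.mul_left ((s : ℤ) - D.E t))).trans (dvd_of_eq (by ring))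

end Ladder

/-! ### Words in the arrows, and moving a clockwise arrow to the front -/

namespace Ladder

/-- Elements of a monoid satisfying the relations of the reconstruction algebra. The vertex `0` is
also regarded as the vertex `n + 1`, `C t` is the clockwise path `0 → n → ⋯ → t`, and `A t` the
anticlockwise path `0 → 1 → ⋯ → t`. -/
structure Rep (D : Ladder) (M : Type*) [Monoid M] where
  e : ℕ → M
  c : ℕ → M
  a : ℕ → M
  k : ℕ → M
  C : ℕ → M
  A : ℕ → M
  C_n : C D.n = c (D.n + 1)
  C_succ : ∀ t < D.n, C t = C (t + 1) * c (t + 1)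
  A_zero : A 0 = 1
  A_succ : ∀ t < D.n, A (t + 1) = A t * a t
  c_one : c 1 = k 0
  same : ∀ s ≤ D.N, D.l (s + 1) = D.l s → k s * A (D.l s) = k (s + 1) * C (D.l s)
  -- One family covers `comm₂` (equal tails), `link₂` (the tail changes) and `twoLast` (the last
  -- label is `2`).
  cycle : ∀ s ≤ D.N, A (D.l s) * k s = C (D.l (s + 1)) * k (s + 1)
  two : ∀ t, 1 ≤ t → t + 1 < D.n → D.E (t + 1) = D.E t →
    c (t + 1) * a t = a (t + 1) * c (t + 2)
  first : ∀ s ≤ D.N, D.l (s + 1) ≠ D.l s → ∀ t, D.l (s + 1) = t + 1 →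
    c (t + 1) * a t = k (s + 1) * C (t + 1)
  lastOf : ∀ s ≤ D.N, D.l (s + 1) ≠ D.l s → ∀ t, D.l s = t + 1 →
    k s * A (t + 1) = a (t + 1) * c (t + 2)

variable {D : Ladder} {M : Type*} [Monoid M]

/-- `Word ρ j i p q x` says that `x` is given by a path from `i` to `j` of degree `x ^ p y ^ q`. -/
inductive Word (ρ : D.Rep M) (j : ℕ) : ℕ → ℤ → ℤ → M → Prop
  | nil : Word ρ j j 0 0 (ρ.e j)
  | c₀ {p q : ℤ} {x : M} : Word ρ j D.n p q x → Word ρ j 0 (p + D.I D.n) q (ρ.c (D.n + 1) * x)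
  -- The bounds in `c` and `a` leave out the arrows `1 → 0` and `n → 0`, which occur as `k 0` and `k
  -- (N + 1)`.
  | c {t : ℕ} {p q : ℤ} {x : M} : 1 ≤ t → t < D.n → Word ρ j t p q x →
      Word ρ j (t + 1) (p + (D.I t - D.I (t + 1))) q (ρ.c (t + 1) * x)
  | a {t : ℕ} {p q : ℤ} {x : M} : t < D.n → Word ρ j (t + 1) p q x →
      Word ρ j t p (q + (D.J (t + 1) - D.J t)) (ρ.a t * x)
  | k {s : ℕ} {p q : ℤ} {x : M} : s ≤ D.N + 1 → Word ρ j 0 p q x →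
      Word ρ j (D.l s) (p + D.X s) (q + D.Y s) (ρ.k s * x)

namespace Word

variable {ρ : D.Rep M} {j i : ℕ} {p q : ℤ} {x : M}

theorem cast {i' : ℕ} {p' q' : ℤ} {x' : M} (h : Word ρ j i p q x) (hi : i = i') (hp : p = p')
    (hq : q = q') (hx : x = x') : Word ρ j i' p' q' x' := by
  subst hi hp hq hx
  exact h

theorem nonneg (h : Word ρ j i p q x) : 0 ≤ p ∧ 0 ≤ q := by
  induction h with
  | nil => simp
  | c₀ _ ih => have := D.I_pos (t := D.n) le_rfl; omega
  | c _ ht _ ih => have := D.I_lt _ ht.le; omega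
  | a ht _ ih => have := D.J_lt ht.le; omega
  | k hs _ ih => have := D.X_nonneg hs; have := D.Y_nonneg hs; omega

/-- Each arrow from `i` to `i'` has degree congruent to `I i' - I i` under the weight `p + I 1 * q`,
and this telescopes. In particular cycles have invariant degree. -/
theorem dvd (h : Word ρ j i p q x) :
    D.I 0 ∣ p + D.I 1 * q + D.I i - D.I j := by
  induction h with
  | nil => simp
  | c₀ _ ih => exact (dvd_add ih (dvd_refl (D.I 0))).trans (dvd_of_eq (by ring))
  | c _ ht _ ih => exact ih.trans (dvd_of_eq (by ring))
  | @a t p q x ht _ ih =>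
    have h1 := D.dvd_I_sub t (by omega)
    have h2 := D.dvd_I_sub (t + 1) (by omega)
    exact (dvd_add ih (dvd_sub h1 h2)).trans (dvd_of_eq (by ring))
  | k hs _ ih =>
    have h1 := D.dvd_X_add hs
    exact (dvd_sub (dvd_add ih h1) (dvd_refl (D.I 0))).trans (dvd_of_eq (by ring))

theorem C_mul {t : ℕ} (h1 : 1 ≤ t) (ht : t ≤ D.n) (h : Word ρ j t p q x) :
    Word ρ j 0 (p + D.I t) q (ρ.C t * x) := by
  induction d : D.n - t generalizing t p x with
  | zero =>
    obtain rfl : t = D.n := by omega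
    rw [ρ.C_n]
    exact h.c₀
  | succ d ih =>
    rw [ρ.C_succ t (by omega), mul_assoc]
    exact (ih (by omega) (by omega) (h.c h1 (by omega)) (by omega)).cast rfl (by ring) rfl rfl

theorem A_mul {t : ℕ} (ht : t ≤ D.n) (h : Word ρ j t p q x) :
    Word ρ j 0 p (q + D.J t) (ρ.A t * x) := by
  induction t generalizing q x with
  | zero =>
    rw [ρ.A_zero, one_mul, D.J_zero, add_zero]
    exact h
  | succ t ih =>
    rw [ρ.A_succ t (by omega), mul_assoc]
    exact (ih (by omega) (h.a (by omega))).cast rfl rfl (by ring) rfl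

theorem c_one_mul (h : Word ρ j 0 p q x) :
    Word ρ j 1 (p + (D.I 0 - D.I 1)) q (ρ.c 1 * x) := by
  rw [ρ.c_one]
  exact (h.k (s := 0) (by omega)).cast D.l_zero (by rw [D.X_zero]) (by simp [D.Y_zero]) rfl

/-- The word starts with the clockwise arrow leaving `i`. -/
def StartsC (ρ : D.Rep M) (j i : ℕ) (p q : ℤ) (x : M) : Prop :=
  match i with
  | 0 => ∃ y, Word ρ j D.n (p - D.I D.n) q y ∧ x = ρ.c (D.n + 1) * y
  | t + 1 => ∃ y, Word ρ j t (p - (D.I t - D.I (t + 1))) q y ∧ x = ρ.c (t + 1) * y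

/-- The degree of the clockwise arrow leaving `i`. -/
def degC (D : Ladder) (i : ℕ) : ℤ :=
  match i with
  | 0 => D.I D.n
  | t + 1 => D.I t - D.I (t + 1)

/-- Words at `i` of total degree less than `m` whose `x`-degree is large enough start with the
clockwise arrow leaving `i`. -/
def FactorsBelow (ρ : D.Rep M) (j : ℕ) (m : ℤ) : Prop :=
  ∀ i p q x, i ≤ D.n → Word ρ j i p q x → p + q < m → degC D i ≤ p → StartsC ρ j i p q x

/-- The arrows of `C t` are split off one at a time, from the vertex `0` on. After `C (t + 1)` is
removed, an `x`-degree of at least `I t - I (t + 1)` is left, which is what the next clockwise arrow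
needs. -/
theorem exists_eq_C_mul {m : ℤ} (ih : FactorsBelow ρ j m) (h : Word ρ j 0 p q x) (hm : p + q < m)
    {t : ℕ} (h1 : 1 ≤ t) (ht : t ≤ D.n) (hp : D.I t ≤ p) :
    ∃ y, Word ρ j t (p - D.I t) q y ∧ x = ρ.C t * y := by
  induction d : D.n - t generalizing t with
  | zero =>
    obtain rfl : t = D.n := by omega
    rw [ρ.C_n]
    exact ih 0 p q x (by omega) h hm hp
  | succ d ihd =>
    have hI := D.I_lt t ht
    obtain ⟨y, hy, rfl⟩ := ihd (t := t + 1) (by omega) (by omega) (by omega) (by omega)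
    have hI' := D.I_pos (t := t + 1) (by omega)
    obtain ⟨z, hz, rfl⟩ := ih (t + 1) _ _ y (by omega) hy (by omega)
      (show D.I t - D.I (t + 1) ≤ _ by omega)
    refine ⟨z, hz.cast rfl (by ring) rfl rfl, ?_⟩
    rw [ρ.C_succ t (by omega), mul_assoc]

/-- Surplus `x`-degree behind `k_{s+1}` yields a factor `C`. If `k_s` leaves the same vertex,
`k_{s+1} C = k_s A` lowers the index; at the first arrow of a vertex, `k_{s+1} C = c a` already
begins with the clockwise arrow. At vertex `1` the descent ends with `k_0 = c_1`. -/
theorem startsC_k_mul {m : ℤ} (ih : FactorsBelow ρ j m) {s : ℕ} (hs : s ≤ D.N + 1)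
    (h : Word ρ j 0 p q x) (hm : p + q + (D.X s + D.Y s) ≤ m)
    (hp : degC D (D.l s) ≤ p + D.X s) :
    StartsC ρ j (D.l s) (p + D.X s) (q + D.Y s) (ρ.k s * x) := by
  induction s generalizing p q x with
  | zero =>
    rw [D.l_zero]
    exact ⟨x, h.cast rfl (by rw [D.X_zero]; ring) (by rw [D.Y_zero]; ring) rfl, by rw [ρ.c_one]⟩
  | succ s ihs =>
    have hs' : s ≤ D.N := by omega
    have hpos := D.X_add_Y_pos hs
    obtain ⟨t, ht, hl, -⟩ := D.l_bounds hs
    by_cases hsame : D.l (s + 1) = D.l s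
    · obtain ⟨t', ht', hl', -, -, -, -, -, hE⟩ := D.l_bounds (s := s) (by omega)
      obtain rfl : t = t' := by omega
      have hX := D.X_succ hsame
      have hY := D.Y_succ hsame
      -- `X (s + 1)` falls short of the clockwise degree by `s + 1 - E t ≥ 1` multiples of `I (t +
      -- 1)`, and `p` has to supply them.
      have hIp : D.I (t + 1) ≤ p := by
        rw [hl] at hp
        have h2 := D.I_rec t ht
        have h3 := D.I_lt (t + 1) (by omega)
        have h4 : (s : ℤ) ≤ D.E (t + 1) := by exact_mod_cast hE (by omega)
        have h5 := D.l_bounds hs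
        obtain ⟨t', -, hl'', -, -, -, h6, -⟩ := h5
        obtain rfl : t = t' := by omega
        have h7 : (D.E t : ℤ) ≤ s := by have := h6 (by omega); omega
        have h8 := D.I_pos (t := t + 1) (by omega)
        have hp' : D.I t - D.I (t + 1) ≤ p + D.X (s + 1) := hp
        rw [D.X_eq hl] at hp'
        push_cast at hp'
        nlinarith
      obtain ⟨y, hy, rfl⟩ := exists_eq_C_mul ih h (by omega) (by omega) (by omega) hIp
      have hA := hy.A_mul (by omega)
      rw [hl'] at hX hY
      have := ihs (by omega) hA (by omega) (by rw [← hsame]; omega)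
      rw [hsame]
      rw [← mul_assoc] at this ⊢
      have hrel := ρ.same s hs' hsame
      rw [hl'] at hrel
      rw [hrel] at this
      convert this using 1
      · rw [hX]; ring
      · rw [hY]; ring
    · have hX := D.X_first hs' hsame hl
      have hY := D.Y_first hs' hsame hl
      rw [hl] at hp ⊢
      have hp' : D.I t - D.I (t + 1) ≤ p + D.X (s + 1) := hp
      obtain ⟨t', h1, -, hl', -⟩ := D.l_first hs' hsame
      obtain rfl : t = t' := by omega
      obtain ⟨y, hy, rfl⟩ := exists_eq_C_mul ih h (by omega) (t := t + 1) (by omega) (by omega)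
        (by omega)
      refine ⟨ρ.a t * y, (hy.a ht).cast rfl (by omega) (by omega) rfl, ?_⟩
      rw [← mul_assoc, ← mul_assoc, ρ.first s hs' hsame t hl]

/-- The relation at vertex `t + 1` turns `a c` into `k_s A`, with `k_s` the last arrow leaving it,
or into `c a` if no `k_s` leaves it. -/
theorem startsC_a_mul_c_mul {m : ℤ} (ih : FactorsBelow ρ j m) {t : ℕ} (ht : t + 1 < D.n)
    (h : Word ρ j (t + 1) p q x)
    (hm : p + (D.I (t + 1) - D.I (t + 2)) + (q + (D.J (t + 2) - D.J (t + 1))) ≤ m)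
    (hp : degC D (t + 1) ≤ p + (D.I (t + 1) - D.I (t + 2))) :
    StartsC ρ j (t + 1) (p + (D.I (t + 1) - D.I (t + 2))) (q + (D.J (t + 2) - D.J (t + 1)))
      (ρ.a (t + 1) * (ρ.c (t + 2) * x)) := by
  rcases D.exists_lastOf_or t ht with ⟨s, hs, hl, hne⟩ | ⟨h1, hE⟩
  · have hX := D.X_lastOf hs hne hl
    have hY := D.Y_lastOf hs hne hl
    have := startsC_k_mul ih (s := s) (by omega) (h.A_mul (by omega)) (by omega)
      (by rw [hl]; omega)
    rw [hl, ← mul_assoc, ρ.lastOf s hs hne t hl, mul_assoc] at this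
    convert this using 1
    · omega
    · omega
  · have hI := D.I_rec t (by omega)
    have hJ := D.J_rec t (by omega)
    rw [hE] at hI hJ
    refine ⟨ρ.a t * x, (h.a (by omega)).cast rfl ?_ ?_ rfl, ?_⟩
    · linarith
    · linarith
    · rw [← mul_assoc, ← ρ.two t h1 ht hE, mul_assoc]

theorem startsC_congr {p' q' : ℤ} {x' : M} (h : StartsC ρ j i p q x) (hp : p = p') (hq : q = q')
    (hx : x = x') : StartsC ρ j i p' q' x' := by
  subst hp hq hx
  exact h

theorem startsC_C_mul {t : ℕ} (h1 : 1 ≤ t) (ht : t ≤ D.n) (h : Word ρ j t p q x) :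
    StartsC ρ j 0 (p + D.I t) q (ρ.C t * x) := by
  induction d : D.n - t generalizing t p x with
  | zero =>
    obtain rfl : t = D.n := by omega
    rw [ρ.C_n]
    exact ⟨x, h.cast rfl (by ring) rfl rfl, rfl⟩
  | succ d ih =>
    rw [ρ.C_succ t (by omega), mul_assoc]
    exact startsC_congr (ih (by omega) (by omega) (h.c h1 (by omega)) (by omega)) (by ring) rfl rfl

/-- The relation `cycle` replaces `A k_s` by `C k_{s+1}`, and every `C` begins with the clockwise
arrow at `0`; no degree condition is needed. -/
theorem startsC_A_mul_k_mul {s : ℕ} (hs : s ≤ D.N) (h : Word ρ j 0 p q x) :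
    StartsC ρ j 0 (p + D.X s) (q + D.Y s + D.J (D.l s)) (ρ.A (D.l s) * (ρ.k s * x)) := by
  obtain ⟨t, ht, hl, -⟩ := D.l_bounds (s := s + 1) (by omega)
  rw [← mul_assoc, ρ.cycle s hs, mul_assoc]
  refine startsC_congr (startsC_C_mul (by omega) (by omega) (h.k (s := s + 1) (by omega))) ?_ ?_ rfl
  · rw [D.X_eq_X_succ_add hs]; ring
  · rw [D.Y_succ_eq hs]; ring

/-- The last arrow of `A` meets `c`. Across a vertex without arrows `k_s` the two are exchanged and
the index drops; otherwise they become `k_s A` and `startsC_A_mul_k_mul` applies. The descent stops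
at vertex `1` at the latest, because `k_0` leaves it. -/
theorem startsC_A_mul_c_mul {t : ℕ} (h1 : 1 ≤ t) (ht : t < D.n) (h : Word ρ j t p q x) :
    StartsC ρ j 0 (p + (D.I t - D.I (t + 1))) (q + D.J (t + 1)) (ρ.A (t + 1) * (ρ.c (t + 1) * x)) := by
  induction t generalizing p q x with
  | zero => omega
  | succ t ih =>
    rw [ρ.A_succ (t + 1) ht, mul_assoc, ← mul_assoc (ρ.a (t + 1))]
    rcases D.exists_lastOf_or t ht with ⟨s, hs, hl, hne⟩ | ⟨h2, hE⟩
    · have := startsC_A_mul_k_mul hs (h.A_mul (by omega))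
      rw [hl] at this
      rw [← ρ.lastOf s hs hne t hl]
      refine startsC_congr this ?_ ?_ (by simp only [mul_assoc])
      · rw [D.X_lastOf hs hne hl]
      · have := D.Y_lastOf hs hne hl
        linarith
    · have hI := D.I_rec t (by omega)
      have hJ := D.J_rec t (by omega)
      rw [hE] at hI hJ
      rw [← ρ.two t h2 ht hE, mul_assoc]
      refine startsC_congr (ih h2 (by omega) (h.a (by omega))) ?_ ?_ rfl
      · linarith
      · linarith

/-- Anticlockwise arrows are absorbed into `A` until a `c` or a `k_s` follows. Only `k_{N+1}` needs
the inductive hypothesis: it has no successor, but its `x`-degree is `0`, so the rest begins with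
the arrow `0 → n`, and `k_{N+1}` followed by that arrow can be rewritten. -/
theorem startsC_A_mul {m : ℤ} (ih : FactorsBelow ρ j m) (h : Word ρ j i p q x) (h1 : 1 ≤ i)
    (hi : i ≤ D.n) (hm : p + (q + D.J i) ≤ m) (hp : D.I D.n ≤ p) :
    StartsC ρ j 0 p (q + D.J i) (ρ.A i * x) := by
  have hIn := D.I_pos (t := D.n) le_rfl
  induction h with
  | nil => omega
  | c₀ => omega
  | c h2 h3 h => exact startsC_A_mul_c_mul h2 h3 h
  | @a t p q x h3 h ih' =>
    have := ih' (by omega) (by omega) (by omega) hp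
    refine startsC_congr this rfl (by ring) ?_
    rw [ρ.A_succ t h3, mul_assoc]
  | @k s p q x hs h =>
    rcases Nat.lt_or_ge D.N s with h2 | h2
    · obtain rfl : s = D.N + 1 := by omega
      have hJ := D.J_pos (t := D.n - 1) (by omega)
      rw [Nat.sub_add_cancel D.one_le_n] at hJ
      have hX := D.X_add_Y_pos (s := D.N + 1) le_rfl
      rw [D.l_last] at hm
      have hX' := D.X_last
      have hYl := D.Y_last
      obtain ⟨y, hy, rfl⟩ := ih 0 p q x (by omega) h (by omega) (show D.I D.n ≤ p by omega)
      by_cases hsame : D.l (D.N + 1) = D.l D.N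
      · have := startsC_A_mul_k_mul (s := D.N) le_rfl (hy.A_mul le_rfl)
        have hrel := ρ.same D.N le_rfl hsame
        rw [← hsame, D.l_last] at hrel this
        rw [← mul_assoc (ρ.k _), hrel, ρ.C_n] at this
        rw [D.l_last]
        have hX1 := D.X_succ hsame
        have hY1 := D.Y_succ hsame
        rw [← hsame, D.l_last] at hX1 hY1
        refine startsC_congr this ?_ ?_ (by simp only [mul_assoc])
        · rw [hX1]; ring
        · rw [hY1]; ring
      · obtain ⟨t, h3, h4, hl, -⟩ := D.l_first le_rfl hsame
        have hX1 := D.X_first le_rfl hsame hl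
        have hY1 := D.Y_first le_rfl hsame hl
        have hn : D.n = t + 1 := by rw [← hl, D.l_last]
        have := startsC_A_mul_c_mul h3 h4 ((hy.cast hn rfl rfl rfl).a h4)
        rw [← mul_assoc (ρ.c _), ρ.first D.N le_rfl hsame t hl] at this
        rw [hl]
        refine startsC_congr this ?_ ?_ ?_
        · rw [hn]; linarith
        · linarith
        · rw [← hn, ρ.C_n]; simp only [mul_assoc]
    · exact startsC_A_mul_k_mul h2 h

theorem factorsBelow (ρ : D.Rep M) (j : ℕ) (m : ℕ) : FactorsBelow ρ j m := by
  induction m with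
  | zero =>
    intro i p q x _ h hm _
    have := h.nonneg
    omega
  | succ m ih =>
    intro i p q x hi h hm hp
    have hIn := D.I_pos (t := D.n) le_rfl
    push_cast at hm
    cases h with
    | nil =>
      exfalso
      rcases j with _ | t
      · exact absurd hp (not_le.2 hIn)
      · have := D.I_lt t (by omega)
        have hp' : D.I t - D.I (t + 1) ≤ 0 := hp
        omega
    | c₀ h => exact ⟨_, h.cast rfl (by ring) rfl rfl, rfl⟩
    | c h1 h2 h => exact ⟨_, h.cast rfl (by ring) rfl rfl, rfl⟩
    | @a _ _ q x h1 h =>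
      rcases i with _ | t
      · have := startsC_A_mul ih h le_rfl D.one_le_n
          (by rw [zero_add, D.J_zero, D.J_one] at hm; rw [zero_add, D.J_one]; omega) hp
        refine startsC_congr this rfl (by simp [D.J_zero]) ?_
        rw [ρ.A_succ 0 h1, ρ.A_zero, one_mul]
      · have hJ : D.J (t + 1) < D.J (t + 2) := D.J_lt h1.le
        have hc := D.I_convex (t := t) (by omega)
        have hp' : D.I t - D.I (t + 1) ≤ p := hp
        change p + (q + (D.J (t + 2) - D.J (t + 1))) < _ at hm
        -- By `I_convex` the rest of the word has enough `x`-degree to begin with its own clockwise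
        -- arrow, producing a factor `a c`.
        obtain ⟨y, hy, rfl⟩ : ∃ y, Word ρ j (t + 1) (p - (D.I (t + 1) - D.I (t + 2))) q y ∧
          x = ρ.c (t + 2) * y := ih (t + 2) p q x (by omega) h (by omega)
          (show D.I (t + 1) - D.I (t + 2) ≤ p by omega)
        have := startsC_a_mul_c_mul ih h1 hy (by omega) (by
          show D.I t - D.I (t + 1) ≤ _
          omega)
        exact startsC_congr this (by ring) rfl rfl
    | k hs h => exact startsC_k_mul ih hs h (by omega) hp

/-- A path whose `x`-degree is at least that of the clockwise arrow leaving its first vertex is equal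
to a path that starts with this arrow. -/
theorem startsC (h : Word ρ j i p q x) (hi : i ≤ D.n) (hp : degC D i ≤ p) :
    StartsC ρ j i p q x :=
  factorsBelow ρ j ((p + q).toNat + 1) i p q x hi h (by omega) hp

theorem exists_eq_C_mul' (h : Word ρ j 0 p q x) {t : ℕ} (h1 : 1 ≤ t) (ht : t ≤ D.n)
    (hp : D.I t ≤ p) : ∃ y, Word ρ j t (p - D.I t) q y ∧ x = ρ.C t * y :=
  exists_eq_C_mul (factorsBelow ρ j ((p + q).toNat + 1)) h (by omega) h1 ht hp

/-! ### Uniqueness of paths with given ends and degree -/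

/-- Paths with the same tail and the same degree are equal. -/
theorem k_mul_eq {m : ℤ} (ih : ∀ {i p q x y}, i ≤ D.n → p + q < m → Word ρ j i p q x →
      Word ρ j i p q y → x = y) {s d : ℕ} {p' q' : ℤ} {x' : M} (hs : s + d ≤ D.N + 1)
    (hl : D.l (s + d) = D.l s) (h : Word ρ j 0 p q x) (h' : Word ρ j 0 p' q' x')
    (hp : p + D.X s = p' + D.X (s + d)) (hq : q + D.Y s = q' + D.Y (s + d))
    (hm : p + q + (D.X s + D.Y s) ≤ m) : ρ.k s * x = ρ.k (s + d) * x' := by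
  induction d generalizing p' q' x' with
  | zero =>
    have := D.X_add_Y_pos hs
    rw [ih (by omega) (by simp at this; omega) h (h'.cast rfl (by simpa using hp.symm)
      (by simpa using hq.symm) rfl), add_zero]
  | succ d ihd =>
    obtain ⟨t, ht, hlt, -, -, -, h3, -, h11⟩ := D.l_bounds hs
    obtain ⟨t', ht', hlt', h5, -⟩ := D.l_bounds (s := s) (by omega)
    obtain rfl : t = t' := by omega
    have hmid : D.l (s + d) = t + 1 := by
      rcases Nat.eq_zero_or_pos d with rfl | hd
      · exact hlt'
      refine D.l_unique (by omega) ?_ (by omega)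
      by_cases hN : s + (d + 1) = D.N + 1
      · rw [hN, D.l_last] at hlt
        rw [← hlt, D.E_n]
        omega
      · have := h11 hN
        omega
    have hsame : D.l (s + d + 1) = D.l (s + d) := by rw [hmid, ← hlt]; rfl
    have hX := D.X_succ hsame
    have hY := D.Y_succ hsame
    rw [hmid] at hX hY
    -- Passing from `k_s` to `k_{s+d+1}` loses `(d + 1) * I (t + 1)` of `x`-degree, so `x'`
    -- contributes at least that much and contains a factor `C`.
    have hIp : D.I (t + 1) ≤ p' := by
      have h6 : D.X s = D.X (s + (d + 1)) + (d + 1 : ℕ) * D.I (t + 1) := by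
        rw [D.X_eq hlt, D.X_eq hlt']; push_cast; ring
      have h7 := h.nonneg
      have h8 := D.I_pos (t := t + 1) (by omega)
      push_cast at h6
      nlinarith
    obtain ⟨y, hy, rfl⟩ := h'.exists_eq_C_mul' (t := t + 1) (by omega) (by omega) hIp
    have hrel := ρ.same (s + d) (by omega) hsame
    rw [hmid] at hrel
    rw [show s + (d + 1) = s + d + 1 by rfl, ← mul_assoc, ← hrel, mul_assoc]
    exact ihd (by omega) (by rw [hmid, hlt']) (hy.A_mul (by omega))
      (by rw [hp, hX, show s + (d + 1) = s + d + 1 by rfl]; ring)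
      (by rw [hq, show s + (d + 1) = s + d + 1 by rfl, hY]; ring)

theorem degC_pos (hi : i ≤ D.n) : 0 < degC D i := by
  rcases i with _ | t
  · exact D.I_pos le_rfl
  · have := D.I_lt t (by omega)
    have h : degC D (t + 1) = D.I t - D.I (t + 1) := rfl
    omega

theorem cases_of_lt_degC (h : Word ρ j i p q x) (hp : p < degC D i) :
    (i = j ∧ p = 0 ∧ q = 0 ∧ x = ρ.e j) ∨
    (i < D.n ∧ ∃ y, Word ρ j (i + 1) p (q - (D.J (i + 1) - D.J i)) y ∧ x = ρ.a i * y) ∨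
    ∃ s ≤ D.N + 1, D.l s = i ∧ ∃ y, Word ρ j 0 (p - D.X s) (q - D.Y s) y ∧ x = ρ.k s * y := by
  cases h with
  | nil => exact Or.inl ⟨rfl, rfl, rfl, rfl⟩
  | c₀ h =>
    have h1 : _ < D.I D.n := hp
    have := h.nonneg
    omega
  | @c t p _ _ h1 h2 h =>
    have h1 : p + (D.I t - D.I (t + 1)) < D.I t - D.I (t + 1) := hp
    have := h.nonneg
    omega
  | a h1 h => exact Or.inr (Or.inl ⟨h1, _, h.cast rfl rfl (by ring) rfl, rfl⟩)
  | k hs h => exact Or.inr (Or.inr ⟨_, hs, rfl, _, h.cast rfl (by ring) (by ring) rfl, rfl⟩)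

/-- The last arrow `k_u` leaving `i` has the least `x`-degree among those leaving `i`, namely that
of the clockwise arrow leaving `i + 1`. So `x'` can be made to begin with that arrow, `a c = k_u A`,
and the comparison is between `k_s` and `k_u`. -/
theorem a_mul_eq_k_mul {m : ℤ} (ih : ∀ {i p q x y}, i ≤ D.n → p + q < m → Word ρ j i p q x →
      Word ρ j i p q y → x = y) {s : ℕ} {q' : ℤ} {x' : M} (hs : s ≤ D.N + 1)
    (hl : D.l s = i) (hi : i < D.n) (h : Word ρ j 0 p q x) (h' : Word ρ j (i + 1) (p + D.X s) q' x')
    (hq : q + D.Y s = q' + (D.J (i + 1) - D.J i)) (hm : p + q + (D.X s + D.Y s) ≤ m) :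
    ρ.k s * x = ρ.a i * x' := by
  obtain ⟨t, ht, hlt, h1, h2, h3, h4, h5, h6⟩ := D.l_bounds hs
  obtain rfl : i = t + 1 := by omega
  rcases D.exists_lastOf_or t hi with ⟨u, hu, hlu, hne⟩ | ⟨h7, h8⟩
  · obtain ⟨t', -, hlu', hE⟩ := D.l_lastOf hu hne
    obtain rfl : t' = t := by omega
    have hsu : s ≤ u := by
      rw [hE]
      exact h6 (by omega)
    have hX := D.X_lastOf hu hne hlu
    have hY := D.Y_lastOf hu hne hlu
    have hXX : D.X u ≤ D.X s := by
      rw [D.X_eq hlu, D.X_eq hlt]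
      have := D.I_pos (t := t' + 1) (by omega)
      have : (s : ℤ) ≤ u := by exact_mod_cast hsu
      nlinarith
    have hp0 := h.nonneg
    obtain ⟨y, hy, rfl⟩ := h'.startsC (by omega) (show D.I (t' + 1) - D.I (t' + 2) ≤ _ by omega)
    obtain ⟨d, rfl⟩ : ∃ d, u = s + d := ⟨u - s, by omega⟩
    rw [← mul_assoc, ← ρ.lastOf _ hu hne t' hlu, mul_assoc]
    have hq' : q + D.Y s = q' + (D.J (t' + 2) - D.J (t' + 1)) := hq
    have hy' : Word ρ j (t' + 1) (p + D.X s - (D.I (t' + 1) - D.I (t' + 2))) q' y := hy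
    exact k_mul_eq ih (by omega) (by omega) h (hy'.A_mul (by omega)) (by omega) (by omega) hm
  · by_cases hN : s = D.N + 1
    · have := h5 hN; omega
    · have := h6 hN
      have := h4
      have := h3
      omega

/-- Paths with the same start and the same degree are equal. -/
theorem unique {y : M} (hi : i ≤ D.n) (h : Word ρ j i p q x) (h' : Word ρ j i p q y) : x = y := by
  suffices H : ∀ (m : ℕ) {i : ℕ} {p q : ℤ} {x y : M}, i ≤ D.n → p + q < m → Word ρ j i p q x →
      Word ρ j i p q y → x = y from H ((p + q).toNat + 1) hi (by omega) h h'
  clear h h' hi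
  intro m
  induction m with
  | zero =>
    intro i p q x y _ hm h _
    have := h.nonneg
    omega
  | succ m ih =>
    intro i p q x y hi hm h h'
    have hdeg := degC_pos (D := D) hi
    have hpq := h.nonneg
    push_cast at hm
    by_cases hp : degC D i ≤ p
    · have h1 := h.startsC hi hp
      have h2 := h'.startsC hi hp
      rcases i with _ | t
      · obtain ⟨z, hz, rfl⟩ := h1
        obtain ⟨z', hz', rfl⟩ := h2
        have hdeg' : 0 < D.I D.n := hdeg
        rw [ih le_rfl (by omega) hz hz']
      · obtain ⟨z, hz, rfl⟩ := h1
        obtain ⟨z', hz', rfl⟩ := h2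
        have hdeg' : 0 < D.I t - D.I (t + 1) := hdeg
        rw [ih (by omega) (by omega) hz hz']
    -- Too little `x`-degree for a clockwise start: each word is trivial or begins with `a i` or
    -- some `k s`. Degree excludes a trivial word against a nontrivial one.
    · have hJ : i < D.n → D.J i < D.J (i + 1) := fun h => D.J_lt h.le
      rcases h.cases_of_lt_degC (by omega) with
        ⟨rfl, rfl, rfl, rfl⟩ | ⟨h1, z, hz, rfl⟩ | ⟨s, hs, hl, z, hz, rfl⟩ <;>
      rcases h'.cases_of_lt_degC (by omega) with
        ⟨h2, h3, h4, rfl⟩ | ⟨h2, z', hz', rfl⟩ | ⟨s', hs', hl', z', hz', rfl⟩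
      · rfl
      · have := hz'.nonneg; have := hJ h2; omega
      · have := hz'.nonneg; have := D.X_add_Y_pos hs'; omega
      · have := hz.nonneg; have := hJ h1; omega
      · have := hJ h1
        rw [ih (by omega) (by omega) hz hz']
      · exact (a_mul_eq_k_mul (m := m) ih hs' hl' h1 hz' (hz.cast rfl (by ring) rfl rfl) (by ring)
          (by omega)).symm
      · have := hz.nonneg; have := D.X_add_Y_pos hs; omega
      · exact a_mul_eq_k_mul (m := m) ih hs hl h2 hz (hz'.cast rfl (by ring) rfl rfl) (by ring)
          (by omega)
      · rcases le_total s s' with hss | hss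
        · obtain ⟨d, rfl⟩ : ∃ d, s' = s + d := ⟨s' - s, by omega⟩
          exact k_mul_eq (m := m) ih hs' (by omega) hz hz' (by ring) (by ring) (by omega)
        · obtain ⟨d, rfl⟩ : ∃ d, s = s' + d := ⟨s - s', by omega⟩
          exact (k_mul_eq (m := m) ih hs (by omega) hz' hz (by ring) (by ring) (by omega)).symm

/-! ### Existence of paths -/

theorem cycle_mul {s : ℕ} (hs : s ≤ D.N + 1) (h : Word ρ j 0 p q x) :
    ∃ y, Word ρ j 0 (p + (D.X s + D.I (D.l s))) (q + D.Y s) y := by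
  obtain ⟨t, ht, hl, -⟩ := D.l_bounds hs
  exact ⟨_, ((h.k hs).C_mul (by omega) (by omega)).cast rfl (by ring) rfl rfl⟩

theorem last_cycle_mul (h : Word ρ j 0 p q x) :
    ∃ y, Word ρ j 0 p (q + D.J (D.n + 1)) y := by
  have h1 := (h.k (s := D.N + 1) le_rfl).A_mul (by rw [D.l_last])
  rw [D.X_last, D.l_last] at h1
  exact ⟨_, h1.cast rfl (by ring) (by rw [← D.Y_last]; ring) rfl⟩

/-- Every nonzero invariant monomial is divisible by the degree of one of the elementary cycles at
the vertex `0`. -/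
theorem exists_generator_le (hcop : IsCoprime (D.I 0) (D.I 1)) {u v : ℤ} (hu : 0 ≤ u) (hv : 0 ≤ v)
    (h0 : 0 < u + v) (hdvd : D.I 0 ∣ u + D.I 1 * v) :
    (∃ s ≤ D.N + 1, D.X s + D.I (D.l s) ≤ u ∧ D.Y s ≤ v) ∨ D.J (D.n + 1) ≤ v := by
  have hI0 : 0 < D.I 0 := D.I_pos (by omega)
  rcases hu.eq_or_lt with rfl | hu
  · right
    rw [zero_add] at hdvd h0
    have h1 := hcop.dvd_of_dvd_mul_left hdvd
    have h2 := D.I_mul_J_sub (t := D.n) le_rfl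
    rw [D.I_last, zero_mul, sub_zero] at h2
    exact Int.le_of_dvd h0 ((Dvd.intro_left _ h2).trans h1)
  · left
    -- The point `(u, v)` lies in the half-open cone between `(X + I, Y)` and `(X, Y + J)`.
    -- Consecutive cones share a ray and sweep from the `x`-axis to the `y`-axis, which `0 < u`
    -- excludes.
    obtain ⟨s, hs, h1, h2⟩ : ∃ s ≤ D.N + 1, u * D.Y s ≤ (D.X s + D.I (D.l s)) * v ∧
        D.X s * v < u * (D.Y s + D.J (D.l s)) := by
      by_contra! hcon
      have hall : ∀ s ≤ D.N + 1, u * D.Y s ≤ (D.X s + D.I (D.l s)) * v := by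
        intro s
        induction s with
        | zero =>
          intro _
          rw [D.Y_zero, mul_zero, D.X_zero, D.l_zero]
          have : D.I 0 - D.I 1 + D.I 1 = D.I 0 := by ring
          rw [this]
          positivity
        | succ s ih =>
          intro hs
          rw [D.Y_succ_eq (by omega), ← D.X_eq_X_succ_add (by omega)]
          exact hcon s (by omega) (ih (by omega))
      have := hcon _ le_rfl (hall _ le_rfl)
      rw [D.X_last, zero_mul, D.l_last, D.Y_last] at this
      have h3 := D.J_pos (t := D.n) le_rfl
      have := mul_pos hu h3
      omega
    refine ⟨s, hs, ?_⟩
    have hdet := D.det_eq hs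
    have hX := D.X_nonneg hs
    have hY := D.Y_nonneg hs
    obtain ⟨t, ht, hl, -⟩ := D.l_bounds hs
    have hI := D.I_pos (t := D.l s) (by omega)
    have hJ : 0 < D.J (D.l s) := by rw [hl]; exact D.J_pos (by omega)
    have hdX := D.dvd_X_add hs
    have hdJ := D.dvd_I_sub (D.l s) (by omega)
    generalize D.X s = X at *
    generalize D.Y s = Y at *
    generalize D.I (D.l s) = I at *
    generalize D.J (D.l s) = J at *
    generalize D.I 0 = r at *
    generalize D.I 1 = a at *
    -- Cramer's rule: both numerators are divisible by `r`, which is also the determinant, so `(u,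
    -- v)` has integral coordinates `α` and `β`. The strict inequality gives `1 ≤ α`.
    obtain ⟨β, hβ⟩ : r ∣ (X + I) * v - u * Y :=
      (dvd_sub (hdX.mul_left v) (hdvd.mul_left Y)).trans (dvd_of_eq (by ring))
    obtain ⟨α, hα⟩ : r ∣ u * (Y + J) - X * v :=
      (dvd_sub (hdvd.mul_left (Y + J)) ((dvd_sub hdX hdJ).mul_left v)).trans
        (dvd_of_eq (by ring))
    have hβ0 : 0 ≤ β := by
      by_contra! h
      nlinarith
    have hα1 : 1 ≤ α := by
      by_contra! h
      nlinarith
    have hu' : u = α * (X + I) + β * X := by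
      refine mul_left_cancel₀ hI0.ne' ?_
      linear_combination (-u) * hdet + (X + I) * hα + X * hβ
    have hv' : v = α * Y + β * (Y + J) := by
      refine mul_left_cancel₀ hI0.ne' ?_
      linear_combination (-v) * hdet + Y * hα + (Y + J) * hβ
    constructor
    · rw [hu']; nlinarith [mul_nonneg hβ0 hX]
    · rw [hv']; nlinarith [mul_nonneg hβ0 hY, mul_nonneg hβ0 hJ.le]

/-- A path from the vertex `0` can be extended by a cycle of any invariant degree. -/
theorem exists_mul_of_dvd (hcop : IsCoprime (D.I 0) (D.I 1)) (h : Word ρ j 0 p q x) {u v : ℤ}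
    (hu : 0 ≤ u) (hv : 0 ≤ v) (hdvd : D.I 0 ∣ u + D.I 1 * v) :
    ∃ y, Word ρ j 0 (p + u) (q + v) y := by
  induction d : (u + v).toNat using Nat.strong_induction_on generalizing u v with
  | _ d ih =>
    rcases (add_nonneg hu hv).eq_or_lt with h0 | h0
    · obtain rfl : u = 0 := by omega
      obtain rfl : v = 0 := by omega
      exact ⟨x, by simpa using h⟩
    rcases exists_generator_le hcop hu hv h0 hdvd with ⟨s, hs, h1, h2⟩ | h1
    · have hpos := D.X_add_Y_pos hs
      obtain ⟨t, ht, hl, -⟩ := D.l_bounds hs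
      have hI := D.I_pos (t := D.l s) (by omega)
      obtain ⟨y, hy⟩ := ih _ (by omega) (u := u - (D.X s + D.I (D.l s))) (v := v - D.Y s)
        (by omega) (by omega) ((dvd_sub hdvd (D.dvd_X_add hs)).trans (dvd_of_eq (by ring))) rfl
      obtain ⟨z, hz⟩ := cycle_mul hs hy
      exact ⟨z, hz.cast rfl (by ring) (by ring) rfl⟩
    · have hJ := D.J_pos (t := D.n) le_rfl
      have hd := D.dvd_I_sub (D.n + 1) le_rfl
      rw [D.I_last] at hd
      obtain ⟨y, hy⟩ := ih _ (by omega) (u := u) (v := v - D.J (D.n + 1)) hu (by omega)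
        ((dvd_add hdvd hd).trans (dvd_of_eq (by ring))) rfl
      obtain ⟨z, hz⟩ := last_cycle_mul hy
      exact ⟨z, hz.cast rfl rfl (by ring) rfl⟩

/-- Every invariant monomial is the degree of a cycle at the vertex `t`. -/
theorem exists_cycle (ρ : D.Rep M) (hcop : IsCoprime (D.I 0) (D.I 1)) {t : ℕ} (ht : t ≤ D.n)
    {u v : ℤ} (hu : 0 ≤ u) (hv : 0 ≤ v) (hdvd : D.I 0 ∣ u + D.I 1 * v) :
    ∃ y, Word ρ t t u v y := by
  rcases Nat.eq_zero_or_pos t with rfl | h1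
  · obtain ⟨y, hy⟩ := exists_mul_of_dvd hcop (nil (ρ := ρ) (j := 0)) hu hv hdvd
    exact ⟨y, hy.cast rfl (by ring) (by ring) rfl⟩
  -- Cycles are inserted at the vertex `0`, in front of `C t`; then `C t` is split off at the left,
  -- leaving a cycle at `t`.
  · obtain ⟨y, hy⟩ := exists_mul_of_dvd hcop ((nil (ρ := ρ) (j := t)).C_mul h1 ht) hu hv hdvd
    obtain ⟨z, hz, -⟩ := hy.exists_eq_C_mul' h1 ht (by omega)
    exact ⟨z, hz.cast rfl (by ring) (by ring) rfl⟩

end Word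

end Ladder

/-! ### The numerical data of `A_{r,a}` -/

theorem extraCount_succ (L : List ℕ) (t : ℕ) :
    extraCount L (t + 1) = extraCount L t + (label L (t + 1) - 2) := by
  rw [extraCount, Finset.sum_Icc_succ_top (by omega)]
  rfl

theorem extraCount_mono (L : List ℕ) : Monotone (extraCount L) :=
  monotone_nat_of_le_succ fun t => by rw [extraCount_succ]; omega

/-- The expansion of `r / a` is `⌈r / a⌉` followed by that of `a / (⌈r / a⌉ * a - r)`, so the series
arises from the shorter one by putting `r` in front. -/
theorem exists_iSeries {r a : ℕ} (h : a < r) :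
    ∃ I : ℕ → ℤ, I 0 = r ∧ I 1 = a ∧
      (∀ t < (jungHirzebruch r a).length,
        I (t + 2) = label (jungHirzebruch r a) (t + 1) * I (t + 1) - I t) ∧
      (∀ t ≤ (jungHirzebruch r a).length, I (t + 1) < I t) ∧
      I ((jungHirzebruch r a).length + 1) = 0 := by
  induction a using Nat.strong_induction_on generalizing r with
  | _ a ih =>
    rw [jungHirzebruch]
    split_ifs with h0
    · subst h0
      refine ⟨fun t => if t = 0 then r else 0, by simp, by simp, by simp, ?_, by simp⟩
      intro t ht
      obtain rfl : t = 0 := by simpa using ht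
      simpa using h
    · have h1 := Nat.div_mul_le_self (r + a - 1) a
      have h2 : r ≤ (r ⌈/⌉ a) * a := by
        have := le_smul_ceilDiv (b := r) (Nat.pos_of_ne_zero h0)
        rwa [smul_eq_mul, mul_comm] at this
      have h3 : (r ⌈/⌉ a) * a - r < a := by
        rw [Nat.ceilDiv_eq_add_pred_div]
        omega
      obtain ⟨I, hI0, hI1, hIr, hIl, hIn⟩ := ih _ h3 h3
      refine ⟨fun t => Nat.casesOn t r I, rfl, hI0, ?_, ?_, hIn⟩
      · rintro (_ | t) ht
        · show I 1 = ((r ⌈/⌉ a : ℕ) : ℤ) * I 0 - r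
          rw [hI1, hI0, Nat.cast_sub h2, Nat.cast_mul]
        · exact hIr t (by simpa using ht)
      · rintro (_ | t) ht
        · show I 0 < r
          rw [hI0]
          exact_mod_cast h
        · exact hIl t (by simpa using ht)

/-- The `j`-series. -/
def jSeries (L : List ℕ) : ℕ → ℤ
  | 0 => 0
  | 1 => 1
  | t + 2 => label L (t + 1) * jSeries L (t + 1) - jSeries L t

theorem tail_spec {L : List ℕ} {s : ℕ} (h1 : 1 ≤ s) (h2 : s ≤ extraTotal L) :
    ∃ t < L.length, tail L s = t + 1 ∧ extraCount L t < s ∧ s ≤ extraCount L (t + 1) := by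
  have hmem : L.length ∈ {i | s ≤ extraCount L i} := h2
  have hl : tail L s = sInf {i | s ≤ extraCount L i} := by
    rw [tail, if_neg (by omega), if_neg (by omega)]
  have h3 : s ≤ extraCount L (tail L s) := by
    rw [hl]
    exact Nat.sInf_mem ⟨_, hmem⟩
  have h4 : tail L s ≤ L.length := by
    rw [hl]
    exact Nat.sInf_le hmem
  obtain ⟨t, ht⟩ : ∃ t, tail L s = t + 1 := by
    refine ⟨tail L s - 1, ?_⟩
    rcases Nat.eq_zero_or_pos (tail L s) with h0 | h0
    · rw [h0] at h3
      simp [extraCount] at h3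
      omega
    · omega
  refine ⟨t, by omega, ht, ?_, by rwa [ht] at h3⟩
  by_contra! h5
  have : tail L s ≤ t := by
    rw [hl]
    exact Nat.sInf_le h5
  omega

theorem two_le_label {r a : ℕ} (h : a < r) {t : ℕ} (ht : t < (jungHirzebruch r a).length) :
    2 ≤ label (jungHirzebruch r a) (t + 1) := by
  rw [label, Nat.add_sub_cancel, List.getD_eq_getElem _ _ ht]
  exact two_le_of_mem_jungHirzebruch h _ (List.getElem_mem ht)

theorem label_eq {r a : ℕ} (h : a < r) {t : ℕ} (ht : t < (jungHirzebruch r a).length) :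
    (label (jungHirzebruch r a) (t + 1) : ℤ) =
      (extraCount (jungHirzebruch r a) (t + 1) : ℤ) - extraCount (jungHirzebruch r a) t + 2 := by
  have := two_le_label h ht
  rw [extraCount_succ]
  omega

/-- The numerical data of `A_{r,a}`. -/
def ladder (r a : ℕ) (ha : 0 < a) (har : a < r) : Ladder where
  n := (jungHirzebruch r a).length
  N := extraTotal (jungHirzebruch r a)
  E := extraCount (jungHirzebruch r a)
  l := tail (jungHirzebruch r a)
  I := (exists_iSeries har).choose
  J := jSeries (jungHirzebruch r a)
  one_le_n := by rw [jungHirzebruch, dif_neg ha.ne']; simp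
  E_zero := by simp [extraCount]
  E_n := rfl
  E_succ t := extraCount_mono _ (Nat.le_succ t)
  l_zero := by simp [tail]
  l_last := by simp [tail]
  l_spec _ := tail_spec
  I_lt := (exists_iSeries har).choose_spec.2.2.2.1
  I_last := (exists_iSeries har).choose_spec.2.2.2.2
  I_rec t ht := by rw [(exists_iSeries har).choose_spec.2.2.1 t ht, label_eq har ht]
  J_zero := rfl
  J_one := rfl
  J_rec t ht := by rw [jSeries, label_eq har ht]

section

variable {r a : ℕ} (ha : 0 < a) (har : a < r)

theorem ladder_I_zero : (ladder r a ha har).I 0 = r := (exists_iSeries har).choose_spec.1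

theorem ladder_I_one : (ladder r a ha har).I 1 = a := (exists_iSeries har).choose_spec.2.1

end

/-! ### The indices `u_t`, `v_t` and `V_t` -/

namespace Ladder

variable (D : Ladder)

/-- Vertex `1` is excluded because `k_0` leaves it; in the dual statement vertex `n` is excluded
because of `k_{N+1}`. -/
theorem isLeast_of_E_lt {t : ℕ} (ht : t < D.n) (h0 : 1 ≤ t) (hE : D.E t < D.E (t + 1)) :
    IsLeast {j | j ≤ D.N + 1 ∧ D.l j = t + 1} (D.E t + 1) := by
  have hN := D.E_mono (show t + 1 ≤ D.n by omega)
  rw [D.E_n] at hN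
  refine ⟨⟨by omega, D.l_unique (by omega) (by omega) (by omega)⟩, fun j ⟨h1, h2⟩ => ?_⟩
  obtain ⟨t', -, h3, -, -, h4, h5, -⟩ := D.l_bounds h1
  obtain rfl : t = t' := by omega
  by_cases h : j = 0
  · have := h4 h; omega
  · exact h5 h

theorem isGreatest_of_E_lt {t : ℕ} (ht : t + 1 < D.n) (hE : D.E t < D.E (t + 1)) :
    IsGreatest {j | j ≤ D.N + 1 ∧ D.l j = t + 1} (D.E (t + 1)) := by
  have hN := D.E_mono (show t + 1 ≤ D.n by omega)
  rw [D.E_n] at hN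
  refine ⟨⟨by omega, D.l_unique (by omega) (by omega) (by omega)⟩, fun j ⟨h1, h2⟩ => ?_⟩
  obtain ⟨t', -, h3, -, -, -, -, h4, h5⟩ := D.l_bounds h1
  obtain rfl : t = t' := by omega
  by_cases h : j = D.N + 1
  · have := h4 h; omega
  · exact h5 h

theorem isGreatest_last : IsGreatest {j | j ≤ D.N + 1 ∧ D.l j = D.n} (D.N + 1) :=
  ⟨⟨le_rfl, D.l_last⟩, fun _ h => h.1⟩

theorem isGreatest_l_lt {t : ℕ} (ht : t < D.n) (h0 : 1 ≤ t) :
    IsGreatest {j | j ≤ D.N + 1 ∧ D.l j < t + 1} (D.E t) := by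
  have hN := D.E_mono ht.le
  rw [D.E_n] at hN
  refine ⟨⟨by omega, ?_⟩, fun j ⟨h1, h2⟩ => ?_⟩
  · obtain ⟨t', -, h3, -, -, h5, h6, -⟩ := D.l_bounds (s := D.E t) (by omega)
    rw [h3]
    by_cases h : D.E t = 0
    · have := h5 h; omega
    · by_contra h7
      have := D.E_mono (show t ≤ t' by omega)
      have := h6 h
      omega
  · obtain ⟨t', h7, h3, -, -, -, -, h4, h5⟩ := D.l_bounds h1
    by_cases h : j = D.N + 1
    · have := h4 h; omega
    · exact (h5 h).trans (D.E_mono (by omega))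

end Ladder

theorem vIdx_one (L : List ℕ) : vIdx L 1 = 0 := by
  have : 0 ∈ {j | j ≤ extraTotal L + 1 ∧ tail L j = 1} := ⟨by omega, by simp [tail]⟩
  exact Nat.le_zero.1 (Nat.sInf_le this)

section

variable {r a : ℕ} (ha : 0 < a) (har : a < r)

theorem vIdx_eq {t : ℕ} (ht : t < (ladder r a ha har).n) (h0 : 1 ≤ t)
    (hE : (ladder r a ha har).E t < (ladder r a ha har).E (t + 1)) :
    vIdx (jungHirzebruch r a) (t + 1) = (ladder r a ha har).E t + 1 :=
  ((ladder r a ha har).isLeast_of_E_lt ht h0 hE).csInf_eq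

theorem uIdx_eq {t : ℕ} (ht : t + 1 < (ladder r a ha har).n)
    (hE : (ladder r a ha har).E t < (ladder r a ha har).E (t + 1)) :
    uIdx (jungHirzebruch r a) (t + 1) = (ladder r a ha har).E (t + 1) :=
  ((ladder r a ha har).isGreatest_of_E_lt ht hE).csSup_eq

theorem uIdx_last :
    uIdx (jungHirzebruch r a) (ladder r a ha har).n = (ladder r a ha har).N + 1 :=
  (ladder r a ha har).isGreatest_last.csSup_eq

theorem VIdx_eq {t : ℕ} (ht : t < (ladder r a ha har).n) (h0 : 1 ≤ t) :
    VIdx (jungHirzebruch r a) (t + 1) = (ladder r a ha har).E t := by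
  rw [VIdx, if_neg (by omega)]
  exact ((ladder r a ha har).isGreatest_l_lt ht h0).csSup_eq

theorem ladder_label_eq {t : ℕ} (ht : t < (ladder r a ha har).n) :
    (ladder r a ha har).E (t + 1) + 2 =
      (ladder r a ha har).E t + label (jungHirzebruch r a) (t + 1) := by
  have h1 := two_le_label har ht
  have h2 := extraCount_succ (jungHirzebruch r a) t
  change extraCount _ (t + 1) + 2 = extraCount _ t + _
  omega

end

/-! ### The relations in the reconstruction algebra -/

section

variable (K : Type u) [CommRing K] (L : List ℕ)

/-- The projection of the path algebra onto the reconstruction algebra. -/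
abbrev proj : PathAlg K L →ₐ[K] ReconstructionAlgebra K L := RingQuot.mkAlgHom K (Rel K L)

variable {K L} in
theorem proj_eq {p q : PathAlg K L} (h : Rel K L p q) : proj K L p = proj K L q :=
  RingQuot.mkAlgHom_rel K h

/-- The arrow `k_s`, where for `n = 1` the arrows `c₁, c₂, k₁, k₂, …` from `1` to `0` are numbered
`0, 1, 2, 3, …`. -/
def outArrow (s : ℕ) : PathAlg K L :=
  -- For `n = 1` the arrow `c₂`, which `k` numbers last, comes between `c₁` and `k₁` in the
  -- relations. The shift turns `RelOne` into the families `same` and `cycle`.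
  if L.length = 1 ∧ s ≠ 0 then (if s = 1 then a K L 1 else k K L (s - 1)) else k K L s

theorem outArrow_zero : outArrow K L 0 = c K L 1 := by simp [outArrow, k]

theorem outArrow_of_ne {L : List ℕ} (h : L.length ≠ 1) (s : ℕ) : outArrow K L s = k K L s := by
  simp [outArrow, h]

theorem outArrow_one {L : List ℕ} (h : L.length = 1) : outArrow K L 1 = a K L 1 := by
  simp [outArrow, h]

theorem outArrow_add_two {L : List ℕ} (h : L.length = 1) (s : ℕ) :
    outArrow K L (s + 2) = k K L (s + 1) := by
  simp [outArrow, h]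

theorem Vertex.mk_length_succ : Vertex.mk L (L.length + 1) = Vertex.mk L 0 := by
  exact Fin.ext (show (L.length + 1) % (L.length + 1) = 0 % (L.length + 1) by simp)

theorem c_length_succ : c K L (L.length + 1) = c K L 0 := by
  exact congrArg (fun v : Vertex L => (PathAlgebra.ofArrow (Arrow.cl v : v ⟶ _) : PathAlg K L))
    (Vertex.mk_length_succ L)

theorem C0_length : C0 K L L.length = c K L (L.length + 1) := by
  simp [C0, c_length_succ]

theorem C0_succ {t : ℕ} (ht : t < L.length) : C0 K L t = C0 K L (t + 1) * c K L (t + 1) := by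
  obtain ⟨d, hd⟩ : ∃ d, L.length = t + 1 + d := ⟨L.length - (t + 1), by omega⟩
  rw [C0, C0, hd, show t + 1 + d - t = d + 1 by omega, show t + 1 + d - (t + 1) = d by omega,
    List.range_succ, List.map_append, List.prod_append, mul_assoc]
  simp

theorem A0_zero : A0 K L 0 = 1 := by simp [A0]

theorem A0_succ (t : ℕ) : A0 K L (t + 1) = A0 K L t * a K L t := by
  rw [A0, A0, List.range_succ, List.map_append, List.prod_append]
  simp

theorem A0_one : A0 K L 1 = a K L 0 := by rw [A0_succ, A0_zero, one_mul]

theorem k_last : k K L (extraTotal L + 1) = a K L L.length := by simp [k]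

end

section

variable (K : Type u) [CommRing K] {r a : ℕ} (ha : 0 < a) (har : a < r)

local notation "L" => jungHirzebruch r a

local notation "D" => ladder r a ha har

theorem l_eq_one (hn : (D).n = 1) {s : ℕ} (hs : s ≤ (D).N + 1) : (D).l s = 1 := by
  obtain ⟨t, ht, hl, -⟩ := (D).l_bounds hs
  omega

theorem label_of_length_eq_one (har : a < r) (hn : (L).length = 1) : label L 1 = extraTotal L + 2 := by
  have h1 := two_le_label har (t := 0) (by omega)
  have h2 := extraCount_succ L 0
  have h3 : extraCount L 0 = 0 := by simp [extraCount]
  rw [zero_add] at h1 h2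
  rw [extraTotal, hn]
  omega

theorem same_one (har : a < r) (hn : (L).length = 1) {s : ℕ} (hs : s ≤ extraTotal L) :
    proj K L (outArrow K L s * A0 K L 1) = proj K L (outArrow K L (s + 1) * C0 K L 1) := by
  have hlab := label_of_length_eq_one har hn
  have hC : C0 K L 1 = c K L 0 := by rw [← c_length_succ, ← C0_length, hn]
  rw [A0_one, hC]
  match s with
  | 0 =>
    rw [outArrow_zero, outArrow_one K hn]
    exact (proj_eq (.one hn .base₁)).symm
  | 1 =>
    rw [outArrow_one K hn, outArrow_add_two K hn]
    exact (proj_eq (.one hn (.first₁ (by omega)))).symm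
  | s + 2 =>
    rw [outArrow_add_two K hn, outArrow_add_two K hn (s + 1)]
    exact (proj_eq (.one hn (.next₁ (s + 2) (by omega) (by omega)))).symm

theorem cycle_one (har : a < r) (hn : (L).length = 1) {s : ℕ} (hs : s ≤ extraTotal L) :
    proj K L (A0 K L 1 * outArrow K L s) = proj K L (C0 K L 1 * outArrow K L (s + 1)) := by
  have hlab := label_of_length_eq_one har hn
  have hC : C0 K L 1 = c K L 0 := by rw [← c_length_succ, ← C0_length, hn]
  rw [A0_one, hC]
  match s with
  | 0 =>
    rw [outArrow_zero, outArrow_one K hn]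
    exact (proj_eq (.one hn .base₂)).symm
  | 1 =>
    rw [outArrow_one K hn, outArrow_add_two K hn]
    exact (proj_eq (.one hn (.first₂ (by omega)))).symm
  | s + 2 =>
    rw [outArrow_add_two K hn, outArrow_add_two K hn (s + 1)]
    exact (proj_eq (.one hn (.next₂ (s + 2) (by omega) (by omega)))).symm

/-- If two arrows `k_s`, `k_{s+1}` leave the same vertex and `n ≥ 2`, the label of the vertex is
greater than `2` and the relations between the two arrows are defining relations. -/
theorem same_bounds (hn : 2 ≤ (L).length) {s t : ℕ} (hs : s ≤ (D).N)
    (h : (D).l (s + 1) = (D).l s) (ht : (D).l s = t + 1) :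
    2 < label L (t + 1) ∧ vIdx L (t + 1) ≤ s ∧ s < uIdx L (t + 1) := by
  obtain ⟨t', ht', hl, h1, h2, h3, h4, h5, h6⟩ := (D).l_bounds (s := s) (by omega)
  obtain rfl : t = t' := by omega
  obtain ⟨t', -, hl', h1', h2', h3', h4', h5', h6'⟩ := (D).l_bounds (s := s + 1) (by omega)
  obtain rfl : t = t' := by omega
  have hn' : 2 ≤ (D).n := hn
  have hlab := ladder_label_eq ha har ht'
  have hE : (D).E t < (D).E (t + 1) := by
    by_cases hN : s + 1 = (D).N + 1
    · have h7 := h5' hN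
      rw [h7, (D).E_n]
      have := h4 (fun h0 => by have := h3 h0; omega)
      omega
    · have := h6' hN
      have := h4' (by omega)
      by_cases h0 : s = 0
      · have := h3 h0
        subst this
        rw [(D).E_zero]
        omega
      · have := h4 h0
        omega
  refine ⟨by omega, ?_, ?_⟩
  · rcases Nat.eq_zero_or_pos t with rfl | h0
    · rw [vIdx_one]; omega
    · rw [vIdx_eq ha har ht' h0 hE]
      exact h4 fun h => by have := h3 h; omega
  · by_cases hN : t + 1 = (D).n
    · rw [hN, uIdx_last]; omega
    · rw [uIdx_eq ha har (by omega) hE]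
      have := h6' (fun h => hN (h5' h))
      omega

/-- A new tail either has label greater than `2`, with `k_{s+1}` its first arrow, or is the vertex
`n` with label `2`, which only `k_{N+1}` leaves. This decides between the `link` relations and
`two`, `twoLast`. -/
theorem link_bounds {s t : ℕ} (hs : s ≤ (D).N) (h : (D).l (s + 1) ≠ (D).l s)
    (ht : (D).l (s + 1) = t + 1) : 1 ≤ t ∧ t < (L).length ∧ VIdx L (t + 1) = s ∧
      ((2 < label L (t + 1) ∧ vIdx L (t + 1) = s + 1) ∨
        (label L (t + 1) = 2 ∧ t + 1 = (L).length ∧ s = extraTotal L)) := by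
  obtain ⟨t', h1, h2, h3, h4⟩ := (D).l_first hs h
  obtain rfl : t = t' := by omega
  obtain ⟨t', -, hl', h1', h2', h3', h4', h5', h6'⟩ := (D).l_bounds (s := s + 1) (by omega)
  obtain rfl : t = t' := by omega
  have hlab := ladder_label_eq ha har h2
  have hlab2 := two_le_label har h2
  refine ⟨h1, h2, (VIdx_eq ha har h2 h1).trans h4.symm, ?_⟩
  rcases hlab2.lt_or_eq with h5 | h5
  · exact Or.inl ⟨h5, by rw [vIdx_eq ha har h2 h1 (by omega), ← h4]⟩
  · right
    have hN : s + 1 = (D).N + 1 := by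
      by_contra hN
      have := h6' hN
      omega
    exact ⟨h5.symm, h5' hN, by change s = (D).N; omega⟩

/-- The elements of the reconstruction algebra given by the arrows. -/
def rep : (D).Rep (A K r a) where
  e i := proj K L (PathAlgebra.ofPath (Quiver.Path.nil : Quiver.Path (Vertex.mk L i) _))
  c i := proj K L (c K L i)
  a i := proj K L (Reconstruction.a K L i)
  k s := proj K L (outArrow K L s)
  C t := proj K L (C0 K L t)
  A t := proj K L (A0 K L t)
  C_n := congrArg _ (C0_length K L)
  C_succ t ht := by rw [← map_mul, C0_succ K L ht]
  A_zero := by rw [A0_zero, map_one]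
  A_succ t ht := by rw [← map_mul, A0_succ]
  c_one := by rw [outArrow_zero]
  same s hs h := by
    rw [← map_mul, ← map_mul]
    by_cases hn : (L).length = 1
    · rw [l_eq_one ha har hn (by omega)]
      exact same_one K har hn hs
    · have hn1 := (D).one_le_n
      have hn2 : 2 ≤ (L).length := by change 1 ≤ (L).length at hn1; omega
      obtain ⟨t, ht, hl, -⟩ := (D).l_bounds (s := s) (by omega)
      obtain ⟨h1, h2, h3⟩ := same_bounds ha har hn2 hs h hl
      rw [outArrow_of_ne K hn, outArrow_of_ne K hn, hl]
      exact proj_eq (.step (t + 1) hn2 (by omega) ht (.comm₁ s h1 h2 h3))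
  cycle s hs := by
    rw [← map_mul, ← map_mul]
    by_cases hn : (L).length = 1
    · rw [l_eq_one ha har hn (by omega), l_eq_one ha har hn (by omega)]
      exact cycle_one K har hn hs
    · have hn1 := (D).one_le_n
      have hn2 : 2 ≤ (L).length := by change 1 ≤ (L).length at hn1; omega
      rw [outArrow_of_ne K hn, outArrow_of_ne K hn]
      by_cases h : (D).l (s + 1) = (D).l s
      · obtain ⟨t, ht, hl, -⟩ := (D).l_bounds (s := s) (by omega)
        obtain ⟨h1, h2, h3⟩ := same_bounds ha har hn2 hs h hl
        rw [h, hl]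
        exact proj_eq (.step (t + 1) hn2 (by omega) ht (.comm₂ s h1 h2 h3))
      · obtain ⟨t, ht, hl, -⟩ := (D).l_bounds (s := s + 1) (by omega)
        obtain ⟨h1, h2, hV, ⟨h3, h4⟩ | ⟨h3, h4, h5⟩⟩ := link_bounds ha har hs h hl
        · have := proj_eq (.step (t + 1) hn2 (by omega) h2 (.link₂ (K := K) h3 (by omega)))
          rw [hV, h4] at this
          rw [hl]
          exact this.symm
        · have := proj_eq (.step (t + 1) hn2 (by omega) h2 (.twoLast (K := K) h3 h4))
          rw [hV] at this
          rw [hl]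
          refine this.symm.trans ?_
          rw [h4, C0_length, c_length_succ, h5, k_last]
  two t h1 ht hE := by
    rw [← map_mul, ← map_mul]
    have hlab := ladder_label_eq ha har (t := t) (by omega)
    have ht' : t + 1 < (L).length := ht
    exact proj_eq (.step (t + 1) (by omega) (by omega) ht'.le (.two (by omega)))
  first s hs h t hl := by
    rw [← map_mul, ← map_mul]
    obtain ⟨h1, h2, hV, ⟨h3, h4⟩ | ⟨h3, h4, h5⟩⟩ := link_bounds ha har hs h hl
    · rw [outArrow_of_ne K (by omega)]
      have := proj_eq (.step (t + 1) (by omega) (by omega) h2 (.link₁ (K := K) h3 (by omega)))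
      rw [h4] at this
      exact this
    · rw [outArrow_of_ne K (by omega)]
      refine (proj_eq (.step (t + 1) (by omega) (by omega) h2 (.two (K := K) h3))).trans ?_
      rw [h4, C0_length, h5, k_last]
  lastOf s hs h t hl := by
    rw [← map_mul, ← map_mul]
    obtain ⟨t', ht', hl', hE⟩ := (D).l_lastOf hs h
    obtain rfl : t = t' := by omega
    have ht'' : t + 1 < (L).length := ht'
    have hlab := ladder_label_eq ha har (t := t) (by omega)
    have hlab2 := two_le_label har (t := t) (by omega)
    rw [outArrow_of_ne K (by omega)]
    rcases hlab2.lt_or_eq with h5 | h5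
    · have := proj_eq (.step (t + 1) (by omega) (by omega) ht''.le (.last (K := K) h5 ht''))
      rw [uIdx_eq ha har ht' (by omega), ← hE] at this
      exact this
    -- With label `2` there are no extra arrows, so `k_s` is `k_0`, the vertex is `1`, and the claim
    -- is the relation `two` there.
    · obtain ⟨t', -, hl', -, -, h3, h4, -⟩ := (D).l_bounds (s := s) (by omega)
      obtain rfl : t = t' := by omega
      have h0 : s = 0 := by
        by_contra h0
        have := h4 h0
        omega
      obtain rfl := h3 h0
      subst h0
      rw [← outArrow_of_ne K (by omega), outArrow_zero, A0_one]
      exact proj_eq (.step 1 (by omega) (by omega) (by omega) (.two (K := K) h5.symm))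

end

/-! ### Matrices with one monomial entry -/

section

variable {K : Type u} [CommRing K] {V : Type*} [DecidableEq V]

/-- The exponent of `x ^ p y ^ q`. -/
def expo (p q : ℤ) : Fin 2 →₀ ℕ := Finsupp.single 0 p.toNat + Finsupp.single 1 q.toNat

theorem expo_add {p q p' q' : ℤ} (hp : 0 ≤ p) (hq : 0 ≤ q) (hp' : 0 ≤ p') (hq' : 0 ≤ q') :
    expo p q + expo p' q' = expo (p + p') (q + q') := by
  rw [expo, expo, expo, Int.toNat_add hp hp', Int.toNat_add hq hq', Finsupp.single_add,
    Finsupp.single_add]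
  abel

theorem expo_natCast (d : Fin 2 →₀ ℕ) : expo (d 0) (d 1) = d := by
  ext i
  fin_cases i <;> simp [expo]

theorem expo_apply_zero {p : ℤ} (hp : 0 ≤ p) (q : ℤ) : (expo p q 0 : ℤ) = p := by
  simpa [expo] using hp

theorem expo_apply_one (p : ℤ) {q : ℤ} (hq : 0 ≤ q) : (expo p q 1 : ℤ) = q := by
  simpa [expo] using hq

/-- The matrix `m` has `x ^ p y ^ q` at the place `(i, j)` and zeros elsewhere. -/
structure IsMon (i j : V) (p q : ℤ) (m : Matrix V V (MvPolynomial (Fin 2) K)) : Prop where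
  left_nonneg : 0 ≤ p
  right_nonneg : 0 ≤ q
  eq_single : m = Matrix.single i j (MvPolynomial.monomial (expo p q) 1)

namespace IsMon

variable {i j k : V} {p q p' q' : ℤ} {m m' : Matrix V V (MvPolynomial (Fin 2) K)}

theorem mul [Fintype V] (h : IsMon i j p q m) (h' : IsMon j k p' q' m') :
    IsMon i k (p + p') (q + q') (m * m') where
  left_nonneg := add_nonneg h.1 h'.1
  right_nonneg := add_nonneg h.2 h'.2
  eq_single := by
    rw [h.3, h'.3, Matrix.single_mul_single_same, MvPolynomial.monomial_mul, one_mul,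
      expo_add h.1 h.2 h'.1 h'.2]

theorem eq (h : IsMon i j p q m) (h' : IsMon i j p' q' m') (hp : p = p') (hq : q = q') :
    m = m' := by
  rw [h.3, h'.3, hp, hq]

theorem congr (h : IsMon i j p q m) (hp : p = p') (hq : q = q') : IsMon i j p' q' m := by
  subst hp hq
  exact h

theorem cast {i' j' : V} (h : IsMon i j p q m) (hi : i = i') (hj : j = j') :
    IsMon i' j' p q m := by
  subst hi hj
  exact h

theorem mul_eq_zero [Fintype V] {l : V} (h : IsMon i j p q m) (h' : IsMon k l p' q' m') (hne : k ≠ j) :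
    m * m' = 0 := by
  rw [h.3, h'.3, Matrix.single_mul_single_of_ne]
  exact hne.symm

theorem one_single (i : V) : IsMon (K := K) i i 0 0 (Matrix.single i i 1) :=
  ⟨le_rfl, le_rfl, by simp [expo]⟩

end IsMon

end

/-! ### Vertices -/

namespace Vertex

variable {L : List ℕ}

/-- The number of a vertex. -/
def val (i : Vertex L) : ℕ := Fin.val i

theorem val_le (i : Vertex L) : i.val ≤ L.length := Nat.lt_succ_iff.1 (Fin.is_lt i)

theorem mk_val (i : Vertex L) : mk L i.val = i :=
  Fin.ext (Nat.mod_eq_of_lt (Fin.is_lt i))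

theorem val_mk {t : ℕ} (ht : t ≤ L.length) : (mk L t).val = t :=
  Nat.mod_eq_of_lt (Nat.lt_succ_of_le ht)

theorem clNext_mk_succ {t : ℕ} (ht : t ≤ L.length) : (mk L (t + 1)).clNext = mk L t := by
  rcases ht.eq_or_lt with rfl | ht
  · rw [mk_length_succ]
    refine Fin.ext ?_
    show ((Fin.ofNat (L.length + 1) 0 - 1 : Fin (L.length + 1))).val = L.length % (L.length + 1)
    rw [Nat.mod_eq_of_lt (by omega)]
    rcases h : L.length with _ | m
    · simp
    · simp [Fin.ofNat]
  · refine Fin.ext ?_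
    show ((Fin.ofNat (L.length + 1) (t + 1) - 1 : Fin (L.length + 1))).val = t % (L.length + 1)
    rw [Fin.sub_def]
    show (L.length + 1 - 1 % (L.length + 1) + (t + 1) % (L.length + 1)) % (L.length + 1) = _
    rw [Nat.mod_eq_of_lt (by omega : 1 < L.length + 1), Nat.mod_eq_of_lt (by omega : t + 1 < L.length + 1),
      show L.length + 1 - 1 + (t + 1) = t + (L.length + 1) by omega, Nat.add_mod_right]

theorem acNext_mk (t : ℕ) : (mk L t).acNext = mk L (t + 1) := by
  refine Fin.ext ?_
  show ((Fin.ofNat (L.length + 1) t + 1 : Fin (L.length + 1))).val = (t + 1) % (L.length + 1)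
  rw [Fin.add_def]
  show (t % (L.length + 1) + 1 % (L.length + 1)) % (L.length + 1) = _
  rw [← Nat.add_mod]

end Vertex

/-! ### The degrees of the paths -/

section

variable (K : Type u) [CommRing K] {r a : ℕ} (ha : 0 < a) (har : a < r)

local notation "L" => jungHirzebruch r a

local notation "D" => ladder r a ha har

/-- The degree of an arrow. -/
def arrowDeg {i j : Vertex L} : Arrow L i j → ℤ × ℤ
  | .cl i => (Ladder.Word.degC (D) i.val, 0)
  -- For `n = 1` the arrows into `0` follow the shifted numbering of `outArrow`.
  | .ac i => if (L).length = 1 ∧ i.val = 1 then ((D).X 1, (D).Y 1)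
      else (0, (D).J (i.val + 1) - (D).J i.val)
  | .extra s _ => if (L).length = 1 then ((D).X (s + 1), (D).Y (s + 1)) else ((D).X s, (D).Y s)

/-- The degree of a path. -/
def pathDeg {i : Vertex L} : {j : Vertex L} → Quiver.Path i j → ℤ × ℤ
  | _, .nil => 0
  | _, .cons w f => pathDeg w + arrowDeg ha har f

theorem pathDeg_comp {i j k : Vertex L} (w : Quiver.Path i j) (w' : Quiver.Path j k) :
    pathDeg ha har (w.comp w') = pathDeg ha har w + pathDeg ha har w' := by
  induction w' with
  | nil => simp [pathDeg]
  | cons w' f ih => rw [Quiver.Path.comp_cons, pathDeg, pathDeg, ih, add_assoc]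

theorem pathDeg_toPath {i j : Vertex L} (f : i ⟶ j) :
    pathDeg ha har f.toPath = arrowDeg ha har f := by
  simp [Quiver.Hom.toPath, pathDeg]

theorem c_val (i : Vertex L) : c K L i.val = PathAlgebra.ofArrow (Arrow.cl i : i ⟶ _) :=
  congrArg (fun v : Vertex L => (PathAlgebra.ofArrow (Arrow.cl v : v ⟶ _) : PathAlg K L)) i.mk_val

theorem a_val (i : Vertex L) :
    Reconstruction.a K L i.val = PathAlgebra.ofArrow (Arrow.ac i : i ⟶ _) :=
  congrArg (fun v : Vertex L => (PathAlgebra.ofArrow (Arrow.ac v : v ⟶ _) : PathAlg K L)) i.mk_val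

theorem e_val (i : Vertex L) : (rep K ha har).e i.val =
    proj K L (PathAlgebra.ofPath (Quiver.Path.nil : Quiver.Path i i)) :=
  congrArg (fun v : Vertex L =>
    proj K L (PathAlgebra.ofPath (Quiver.Path.nil : Quiver.Path v v))) i.mk_val

theorem one_le_length (ha : 0 < a) : 1 ≤ (L).length := by
  rw [jungHirzebruch, dif_neg ha.ne']; simp

theorem k_eq_extra {s : ℕ} (hs : 1 ≤ s ∧ s ≤ extraTotal L) :
    k K L s = PathAlgebra.ofArrow (Arrow.extra s hs : _ ⟶ _) := by
  rw [k, if_neg (by omega), dif_pos hs]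

/-- Multiplying a path from the left with an arrow. -/
theorem word_ofArrow_mul {t : ℕ} {i j : Vertex L} (f : i ⟶ j) {p q : ℤ} {x : A K r a}
    (h : (D).Word (rep K ha har) t j.val p q x) :
    (D).Word (rep K ha har) t i.val (p + (arrowDeg ha har f).1) (q + (arrowDeg ha har f).2)
      (proj K L (PathAlgebra.ofArrow f) * x) := by
  have hn := one_le_length (r := r) ha
  change Arrow L i j at f
  cases f with
  | cl =>
    rw [← c_val, arrowDeg]
    have hle := i.val_le
    have hi := i.mk_val
    rcases hv : i.val with _ | s
    · rw [hv, ← Vertex.mk_length_succ] at hi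
      rw [← hi, Vertex.clNext_mk_succ le_rfl, Vertex.val_mk le_rfl] at h
      rw [← c_length_succ]
      exact h.c₀.cast rfl rfl (by simp) rfl
    · rw [hv] at hi hle
      rw [← hi, Vertex.clNext_mk_succ (by omega), Vertex.val_mk (by omega)] at h
      rcases Nat.eq_zero_or_pos s with rfl | hs
      · exact h.c_one_mul.cast rfl rfl (by simp) rfl
      · exact (h.c hs (show s < (D).n from hle)).cast rfl rfl (by simp) rfl
  | ac =>
    rw [← a_val, arrowDeg]
    have hle := i.val_le
    have hi := i.mk_val
    rw [← hi, Vertex.acNext_mk] at h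
    rcases hle.eq_or_lt with hv | hv
    · rw [hv, Vertex.mk_length_succ, Vertex.val_mk (by omega)] at h
      by_cases h1 : (L).length = 1
      · rw [if_pos ⟨h1, by omega⟩]
        have := h.k (s := 1) (by omega)
        rw [l_eq_one ha har h1 (by omega)] at this
        refine this.cast (by omega) rfl rfl ?_
        rw [hv, h1, ← outArrow_one K h1]
        rfl
      · rw [if_neg (by omega)]
        refine (h.k (s := (D).N + 1) le_rfl).cast ?_ ?_ ?_ ?_
        · rw [(D).l_last, hv]; rfl
        · rw [(D).X_last]
        · have := (D).Y_last
          rw [hv]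
          change _ + _ = q + ((D).J ((D).n + 1) - (D).J (D).n)
          omega
        · rw [hv, ← k_last, ← outArrow_of_ne K h1]
          rfl
    · rw [Vertex.val_mk (by omega)] at h
      rw [if_neg (by omega)]
      exact (h.a hv).cast rfl (by simp) rfl rfl
  | extra s hs =>
    rw [← k_eq_extra, arrowDeg]
    rw [Vertex.val_mk (by omega)] at h
    obtain ⟨t', ht', hl, -⟩ := (D).l_bounds (s := s) (by have := hs.2; change s ≤ extraTotal L + 1; omega)
    change tail L s = t' + 1 at hl
    change t' < (L).length at ht'
    rw [Vertex.val_mk (by omega)]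
    have hs2 : s ≤ (D).N := hs.2
    by_cases h1 : (L).length = 1
    · rw [if_pos h1]
      have := h.k (s := s + 1) (by omega)
      rw [l_eq_one ha har h1 (by omega)] at this
      refine this.cast (by omega) rfl rfl ?_
      obtain ⟨s', rfl⟩ : ∃ s', s = s' + 1 := ⟨s - 1, by omega⟩
      rw [← outArrow_add_two K h1]
      rfl
    · rw [if_neg h1]
      refine (h.k (s := s) (by omega)).cast rfl rfl rfl ?_
      rw [← outArrow_of_ne K h1]
      rfl

theorem word_ofPath_mul {t : ℕ} {i j : Vertex L} (w : Quiver.Path i j) {p q : ℤ} {x : A K r a}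
    (h : (D).Word (rep K ha har) t j.val p q x)
    (hx : proj K L (PathAlgebra.ofPath (Quiver.Path.nil : Quiver.Path j j)) * x = x) :
    (D).Word (rep K ha har) t i.val (p + (pathDeg ha har w).1) (q + (pathDeg ha har w).2)
      (proj K L (PathAlgebra.ofPath w) * x) := by
  induction w generalizing p q x with
  | nil => exact h.cast rfl (by simp [pathDeg]) (by simp [pathDeg]) hx.symm
  | @cons k j w f ih =>
    have h1 := ih (word_ofArrow_mul K ha har f h) (by
      rw [← mul_assoc, ← map_mul, PathAlgebra.ofArrow, PathAlgebra.ofPath_mul_ofPath,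
        Quiver.Path.nil_comp])
    rw [← mul_assoc, ← map_mul, PathAlgebra.ofArrow, PathAlgebra.ofPath_mul_ofPath] at h1
    refine h1.cast rfl ?_ ?_ rfl
    · simp only [pathDeg, Prod.fst_add]; ring
    · simp only [pathDeg, Prod.snd_add]; ring

theorem word_ofPath {i j : Vertex L} (w : Quiver.Path i j) :
    (D).Word (rep K ha har) j.val i.val (pathDeg ha har w).1 (pathDeg ha har w).2
      (proj K L (PathAlgebra.ofPath w)) := by
  have he := e_val K ha har j
  refine (word_ofPath_mul K ha har w (.nil (ρ := rep K ha har) (j := j.val)) ?_).cast rfl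
    (by simp) (by simp) ?_
  · rw [he, ← map_mul, PathAlgebra.ofPath_mul_ofPath, Quiver.Path.nil_comp]
  · rw [he, ← map_mul, PathAlgebra.ofPath_mul_ofPath, Quiver.Path.comp_nil]

end

/-! ### The representation by matrices over `K[x, y]` -/

section

variable (K : Type u) [CommRing K] {r a : ℕ} (ha : 0 < a) (har : a < r)

local notation "L" => jungHirzebruch r a

local notation "D" => ladder r a ha har

local notation "Mat" => Matrix (Vertex L) (Vertex L) (MvPolynomial (Fin 2) K)

/-- The linear map that sends a path from `i` to `j` to its degree at the place `(i, j)`. -/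
def pathMatrix : PathAlg K L →ₗ[K] Mat :=
  (PathAlgebra.basis K (Vertex L)).constr K fun w =>
    Matrix.single w.1 w.2.1
      (MvPolynomial.monomial (expo (pathDeg ha har w.2.2).1 (pathDeg ha har w.2.2).2) 1)

theorem isMon_pathMatrix {i j : Vertex L} (w : Quiver.Path i j) :
    IsMon i j (pathDeg ha har w).1 (pathDeg ha har w).2
      (pathMatrix K ha har (PathAlgebra.ofPath w)) where
  left_nonneg := (word_ofPath K ha har w).nonneg.1
  right_nonneg := (word_ofPath K ha har w).nonneg.2
  eq_single := by
    rw [pathMatrix, PathAlgebra.ofPath, Module.Basis.constr_basis]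

theorem pathMatrix_one : pathMatrix K ha har 1 = 1 := by
  rw [PathAlgebra.one_def, map_sum]
  have : ∀ i : Vertex L, pathMatrix K ha har (PathAlgebra.ofPath (Quiver.Path.nil : Quiver.Path i i)) =
      Matrix.single i i 1 := fun i =>
    (isMon_pathMatrix K ha har _).eq (IsMon.one_single i) rfl rfl
  simp only [this, Matrix.sum_single_one]

theorem pathMatrix_mul (f g : PathAlg K L) :
    pathMatrix K ha har (f * g) = pathMatrix K ha har f * pathMatrix K ha har g := by
  induction f using PathAlgebra.span_induction with
  | h0 => simp only [zero_mul, map_zero]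
  | hadd f f' hf hf' => simp only [add_mul, map_add, hf, hf']
  | hpath c i j p =>
  induction g using PathAlgebra.span_induction with
  | h0 => simp only [mul_zero, map_zero]
  | hadd g g' hg hg' => simp only [mul_add, map_add, hg, hg']
  | hpath d k l q =>
  simp only [map_smul, smul_mul_assoc, mul_smul_comm]
  congr 2
  by_cases h : k = j
  · subst h
    rw [PathAlgebra.ofPath_mul_ofPath]
    refine (isMon_pathMatrix K ha har _).eq
      ((isMon_pathMatrix K ha har p).mul (isMon_pathMatrix K ha har q)) ?_ ?_
    · rw [pathDeg_comp, Prod.fst_add]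
    · rw [pathDeg_comp, Prod.snd_add]
  · rw [PathAlgebra.ofPath_mul_ofPath_of_ne _ _ h, map_zero,
      (isMon_pathMatrix K ha har p).mul_eq_zero (isMon_pathMatrix K ha har q) h]

/-- The representation of the path algebra by matrices. -/
def pathHom : PathAlg K L →ₐ[K] Mat :=
  AlgHom.ofLinearMap (pathMatrix K ha har) (pathMatrix_one K ha har) (pathMatrix_mul K ha har)

theorem isMon_ofPath {i j : Vertex L} (w : Quiver.Path i j) :
    IsMon i j (pathDeg ha har w).1 (pathDeg ha har w).2
      (pathHom K ha har (PathAlgebra.ofPath w)) :=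
  isMon_pathMatrix K ha har w

theorem isMon_ofArrow {i j : Vertex L} (f : i ⟶ j) :
    IsMon i j (arrowDeg ha har f).1 (arrowDeg ha har f).2
      (pathHom K ha har (PathAlgebra.ofArrow f)) := by
  rw [← pathDeg_toPath]
  exact isMon_ofPath K ha har _

theorem isMon_c_zero : IsMon (Vertex.mk L 0) (Vertex.mk L (L).length) ((D).I (D).n) 0
    (pathHom K ha har (c K L 0)) := by
  have := isMon_ofArrow K ha har (Arrow.cl (Vertex.mk L 0) : _ ⟶ _)
  rw [arrowDeg, Vertex.val_mk (by omega)] at this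
  have h := Vertex.clNext_mk_succ (le_refl (L).length)
  rw [Vertex.mk_length_succ] at h
  exact this.cast rfl h

theorem isMon_c_succ {t : ℕ} (ht : t ≤ (L).length) :
    IsMon (Vertex.mk L (t + 1)) (Vertex.mk L t) ((D).I t - (D).I (t + 1)) 0
      (pathHom K ha har (c K L (t + 1))) := by
  rcases ht.eq_or_lt with rfl | ht
  · rw [c_length_succ, Vertex.mk_length_succ]
    refine (isMon_c_zero K ha har).congr ?_ rfl
    have := (D).I_last
    change (D).I ((L).length + 1) = 0 at this
    rw [this, sub_zero]
    rfl
  · have := isMon_ofArrow K ha har (Arrow.cl (Vertex.mk L (t + 1)) : _ ⟶ _)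
    rw [arrowDeg, Vertex.val_mk (by omega)] at this
    exact this.cast rfl (Vertex.clNext_mk_succ ht.le)

theorem isMon_a {t : ℕ} (ht : t ≤ (L).length) (h : t < (L).length ∨ (L).length ≠ 1) :
    IsMon (Vertex.mk L t) (Vertex.mk L (t + 1)) 0 ((D).J (t + 1) - (D).J t)
      (pathHom K ha har (Reconstruction.a K L t)) := by
  have := isMon_ofArrow K ha har (Arrow.ac (Vertex.mk L t) : _ ⟶ _)
  rw [arrowDeg, Vertex.val_mk (by omega), if_neg (by omega)] at this
  exact this.cast rfl (Vertex.acNext_mk t)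

theorem isMon_outArrow {s : ℕ} (hs : s ≤ (D).N + 1) :
    IsMon (Vertex.mk L (tail L s)) (Vertex.mk L 0) ((D).X s) ((D).Y s)
      (pathHom K ha har (outArrow K L s)) := by
  have hn := one_le_length (r := r) ha
  rcases Nat.eq_zero_or_pos s with rfl | h0
  · rw [outArrow_zero, (D).X_zero, (D).Y_zero]
    have h := (D).l_zero
    change tail L 0 = 1 at h
    rw [h]
    exact isMon_c_succ K ha har (t := 0) (by omega)
  by_cases hn1 : (L).length = 1
  · have h := l_eq_one ha har hn1 hs
    change tail L s = 1 at h
    rw [h]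
    obtain ⟨s, rfl⟩ : ∃ s', s = s' + 1 := ⟨s - 1, by omega⟩
    rcases s with _ | s
    · rw [outArrow_one K hn1]
      have := isMon_ofArrow K ha har (Arrow.ac (Vertex.mk L 1) : _ ⟶ _)
      rw [arrowDeg, Vertex.val_mk (by omega), if_pos ⟨hn1, rfl⟩] at this
      exact this.cast rfl (by rw [Vertex.acNext_mk, ← Vertex.mk_length_succ, hn1])
    · rw [outArrow_add_two K hn1]
      have hs' : 1 ≤ s + 1 ∧ s + 1 ≤ extraTotal L :=
        ⟨by omega, by change s + 1 + 1 ≤ extraTotal L + 1 at hs; omega⟩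
      rw [k_eq_extra K hs']
      have := isMon_ofArrow K ha har (Arrow.extra (s + 1) hs' : _ ⟶ _)
      have h' : tail L (s + 1) = 1 := l_eq_one ha har hn1 (s := s + 1) (by omega)
      rw [arrowDeg, if_pos hn1] at this
      exact this.cast (by rw [h']) rfl
  · rw [outArrow_of_ne K hn1]
    rcases hs.eq_or_lt with rfl | hs
    · have h : k K L ((D).N + 1) = _ := k_last K L
      rw [h, (D).X_last]
      have hl := (D).l_last
      change tail L ((D).N + 1) = (L).length at hl
      rw [hl, ← Vertex.mk_length_succ]
      refine (isMon_a K ha har le_rfl (Or.inr hn1)).congr rfl ?_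
      have := (D).Y_last
      change _ + (D).J (L).length = (D).J ((L).length + 1) at this
      omega
    · have hs' : 1 ≤ s ∧ s ≤ extraTotal L := ⟨h0, Nat.lt_succ_iff.1 hs⟩
      rw [k_eq_extra K hs']
      have := isMon_ofArrow K ha har (Arrow.extra s hs' : _ ⟶ _)
      rw [arrowDeg, if_neg hn1] at this
      exact this

theorem isMon_outArrow' {s t : ℕ} (hs : s ≤ (D).N + 1) (ht : (D).l s = t) :
    IsMon (Vertex.mk L t) (Vertex.mk L 0) ((D).X s) ((D).Y s)
      (pathHom K ha har (outArrow K L s)) := by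
  subst ht
  exact isMon_outArrow K ha har hs

theorem isMon_C0 {t : ℕ} (ht : t ≤ (L).length) :
    IsMon (Vertex.mk L 0) (Vertex.mk L t) ((D).I t) 0 (pathHom K ha har (C0 K L t)) := by
  induction d : (L).length - t generalizing t with
  | zero =>
    obtain rfl : t = (L).length := by omega
    rw [C0_length, c_length_succ]
    exact isMon_c_zero K ha har
  | succ d ih =>
    rw [C0_succ K L (by omega), map_mul]
    exact ((ih (t := t + 1) (by omega) (by omega)).mul
      (isMon_c_succ K ha har (t := t) (by omega))).congr (by ring) (by ring)

theorem isMon_A0 {t : ℕ} (h1 : 1 ≤ t) (ht : t ≤ (L).length) :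
    IsMon (Vertex.mk L 0) (Vertex.mk L t) 0 ((D).J t) (pathHom K ha har (A0 K L t)) := by
  induction t, h1 using Nat.le_induction with
  | base =>
    rw [A0_one]
    exact (isMon_a K ha har (t := 0) (by omega) (Or.inl (by omega))).congr rfl
      (by rw [(D).J_zero, sub_zero])
  | succ t h1 ih =>
    rw [A0_succ, map_mul]
    exact ((ih (by omega)).mul (isMon_a K ha har (t := t) (by omega) (Or.inl (by omega)))).congr
      (by ring) (by ring)

end

section

variable (K : Type u) [CommRing K] {r a : ℕ} (ha : 0 < a) (har : a < r)

local notation "L" => jungHirzebruch r a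

local notation "D" => ladder r a ha har

local notation "Mat" => Matrix (Vertex L) (Vertex L) (MvPolynomial (Fin 2) K)

/-! ### The relations hold for the matrices -/

theorem pathHom_same {s t : ℕ} (hs : s ≤ (D).N) (hl : (D).l s = t) (hl' : (D).l (s + 1) = t) :
    pathHom K ha har (outArrow K L s * A0 K L t) =
      pathHom K ha har (outArrow K L (s + 1) * C0 K L t) := by
  obtain ⟨t', ht', h1, -⟩ := (D).l_bounds (s := s) (by omega)
  have ht : t ≤ (L).length := by change t' < (L).length at ht'; omega
  have hX := (D).X_succ (hl'.trans hl.symm)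
  have hY := (D).Y_succ (hl'.trans hl.symm)
  rw [hl] at hX hY
  rw [map_mul, map_mul]
  exact ((isMon_outArrow' K ha har (by omega) hl).mul (isMon_A0 K ha har (by omega) ht)).eq
    ((isMon_outArrow' K ha har (by omega) hl').mul (isMon_C0 K ha har ht))
    (by rw [hX, add_zero]) (by rw [hY, add_zero])

theorem pathHom_cycle {s t t' : ℕ} (hs : s ≤ (D).N) (hl : (D).l s = t) (hl' : (D).l (s + 1) = t') :
    pathHom K ha har (A0 K L t * outArrow K L s) =
      pathHom K ha har (C0 K L t' * outArrow K L (s + 1)) := by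
  obtain ⟨i, hi, h1, -⟩ := (D).l_bounds (s := s) (by omega)
  obtain ⟨j, hj, h2, -⟩ := (D).l_bounds (s := s + 1) (by omega)
  change i < (L).length at hi
  change j < (L).length at hj
  have hX := (D).X_eq_X_succ_add hs
  have hY := (D).Y_succ_eq hs
  rw [hl'] at hX
  rw [hl] at hY
  rw [map_mul, map_mul]
  exact ((isMon_A0 K ha har (by omega) (by omega)).mul (isMon_outArrow' K ha har (by omega) hl)).eq
    ((isMon_C0 K ha har (by omega)).mul (isMon_outArrow' K ha har (by omega) hl'))
    (by rw [hX]; ring) (by rw [hY]; ring)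

theorem pathHom_relOne (hn : (L).length = 1) {p q : PathAlg K L} (h : RelOne K L p q) :
    pathHom K ha har p = pathHom K ha har q := by
  have hlab := label_of_length_eq_one har hn
  have hC : C0 K L 1 = c K L 0 := by rw [← c_length_succ, ← C0_length, hn]
  have hN : (D).N = extraTotal L := rfl
  have same := fun s hs => pathHom_same K ha har (s := s) hs (l_eq_one ha har hn (by omega))
    (l_eq_one ha har hn (by omega))
  have cycle := fun s hs => pathHom_cycle K ha har (s := s) hs (l_eq_one ha har hn (by omega))
    (l_eq_one ha har hn (by omega))
  rw [A0_one, hC] at same cycle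
  cases h with
  | base₁ =>
    have := same 0 (by omega)
    rw [outArrow_zero, outArrow_one K hn] at this
    exact this.symm
  | base₂ =>
    have := cycle 0 (by omega)
    rw [outArrow_zero, outArrow_one K hn] at this
    exact this.symm
  | first₁ h =>
    have := same 1 (by omega)
    rw [outArrow_one K hn, outArrow_add_two K hn] at this
    exact this.symm
  | first₂ h =>
    have := cycle 1 (by omega)
    rw [outArrow_one K hn, outArrow_add_two K hn] at this
    exact this.symm
  | next₁ t h1 h2 =>
    obtain ⟨s, rfl⟩ : ∃ s, t = s + 2 := ⟨t - 2, by omega⟩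
    have := same (s + 2) (by omega)
    rw [outArrow_add_two K hn, outArrow_add_two K hn (s + 1)] at this
    exact this.symm
  | next₂ t h1 h2 =>
    obtain ⟨s, rfl⟩ : ∃ s, t = s + 2 := ⟨t - 2, by omega⟩
    have := cycle (s + 2) (by omega)
    rw [outArrow_add_two K hn, outArrow_add_two K hn (s + 1)] at this
    exact this.symm

/-- The arrows `k_s` with `v_t ≤ s ≤ u_t` leave the vertex `t`. -/
theorem l_eq_of_bounds {s t : ℕ} (ht : t < (D).n) (hE : (D).E t < (D).E (t + 1))
    (h1 : vIdx L (t + 1) ≤ s) (h2 : s < uIdx L (t + 1)) :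
    s ≤ (D).N ∧ (D).l s = t + 1 ∧ (D).l (s + 1) = t + 1 := by
  have hN := (D).E_mono (show t + 1 ≤ (D).n by omega)
  rw [(D).E_n] at hN
  have hv : s = 0 ∧ t = 0 ∨ (D).E t < s := by
    rcases Nat.eq_zero_or_pos t with rfl | h0
    · rw [(D).E_zero]; omega
    · rw [vIdx_eq ha har ht h0 hE] at h1; omega
  have hu : s < (D).E (t + 1) ∨ s = (D).N ∧ t + 1 = (D).n := by
    by_cases h : t + 1 = (D).n
    · rw [h, uIdx_last] at h2
      rw [h, (D).E_n]
      omega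
    · rw [uIdx_eq ha har (by omega) hE] at h2
      exact Or.inl h2
  have hE0 := (D).E_zero
  have hEn := (D).E_n
  refine ⟨by omega, ?_, ?_⟩
  · rcases hv with ⟨rfl, rfl⟩ | hv
    · exact (D).l_zero
    · refine (D).l_unique hv ?_ (by omega)
      rcases hu with hu | ⟨hu, hu'⟩
      · omega
      · rw [hu', hEn]; omega
  · rcases hu with hu | ⟨rfl, hu⟩
    · refine (D).l_unique ?_ hu (by omega)
      rcases hv with ⟨rfl, rfl⟩ | hv <;> omega
    · rw [hu, (D).l_last]

/-- Both sides are matrices with a single monomial entry at the same place, so each relation is an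
identity between degrees. -/
theorem pathHom_relStep (hn : 2 ≤ (L).length) {t : ℕ} (ht : t < (L).length)
    {p q : PathAlg K L} (h : RelStep K L (t + 1) p q) : pathHom K ha har p = pathHom K ha har q := by
  have hlab := ladder_label_eq ha har ht
  have hI := (D).I_rec t ht
  have hJ := (D).J_rec t ht
  have hn1 : (L).length ≠ 1 := by omega
  have hD : (D).n = (L).length := rfl
  have hN : (D).N = extraTotal L := rfl
  have hk : ∀ s, k K L s = outArrow K L s := fun s => (outArrow_of_ne K hn1 s).symm
  have hc := isMon_c_succ K ha har (t := t) ht.le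
  have hc' := isMon_c_succ K ha har (t := t + 1) ht
  have haa := isMon_a K ha har (t := t) ht.le (Or.inl ht)
  have haa' := isMon_a K ha har (t := t + 1) ht (Or.inr hn1)
  have hC := isMon_C0 K ha har (t := t + 1) ht
  have hA := isMon_A0 K ha har (t := t + 1) (by omega) ht
  have hlV : ∀ s, tail L s = (D).l s := fun _ => rfl
  cases h with
  | two h =>
    have hE : (D).E (t + 1) = (D).E t := by omega
    rw [hE] at hI hJ
    rw [map_mul, map_mul]
    exact (hc.mul haa).eq (haa'.mul hc') (by linarith) (by linarith)
  | twoLast h hl =>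
    have hE : (D).E (t + 1) = (D).E t := by omega
    rw [hl, ← hD, (D).E_n] at hE
    rw [VIdx_eq ha har ht (by omega), hk, hlV, ← hE,
      pathHom_cycle K ha har le_rfl rfl (D).l_last, hD, C0_length, c_length_succ, hN,
      ← hk, k_last, hl]
  | link₁ h h1 =>
    have hE : (D).E t < (D).E (t + 1) := by omega
    have hNN := (D).E_mono (show t + 1 ≤ (D).n by omega)
    rw [(D).E_n] at hNN
    have hl : (D).l ((D).E t + 1) = t + 1 := (D).l_unique (by omega) (by omega) (by omega)
    rw [vIdx_eq ha har ht (by omega) hE, hk, map_mul, map_mul]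
    refine (hc.mul haa).eq ((isMon_outArrow' K ha har (by omega) hl).mul hC) ?_ ?_
    · rw [(D).X_eq hl]; push_cast; ring
    · rw [(D).Y_eq hl]; push_cast; ring
  | link₂ h h1 =>
    have hE : (D).E t < (D).E (t + 1) := by omega
    have hNN := (D).E_mono (show t + 1 ≤ (D).n by omega)
    rw [(D).E_n] at hNN
    have hl : (D).l ((D).E t + 1) = t + 1 := (D).l_unique (by omega) (by omega) (by omega)
    rw [vIdx_eq ha har ht (by omega) hE, VIdx_eq ha har ht (by omega), hk, hk, hlV]
    exact (pathHom_cycle K ha har (by omega) rfl hl).symm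
  | comm₁ s h h1 h2 =>
    obtain ⟨h3, h4, h5⟩ := l_eq_of_bounds ha har ht (by omega) h1 h2
    rw [hk, hk]
    exact pathHom_same K ha har h3 h4 h5
  | comm₂ s h h1 h2 =>
    obtain ⟨h3, h4, h5⟩ := l_eq_of_bounds ha har ht (by omega) h1 h2
    rw [hk, hk]
    exact pathHom_cycle K ha har h3 h4 h5
  | last h h1 =>
    have hE : (D).E t < (D).E (t + 1) := by omega
    have hNN := (D).E_mono (show t + 1 ≤ (D).n by omega)
    rw [(D).E_n] at hNN
    have hl : (D).l ((D).E (t + 1)) = t + 1 := (D).l_unique (by omega) (by omega) (by omega)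
    rw [uIdx_eq ha har h1 hE, hk, map_mul, map_mul]
    refine ((isMon_outArrow' K ha har (by omega) hl).mul hA).eq (haa'.mul hc') ?_ ?_
    · rw [(D).X_eq hl, hI]; ring
    · rw [(D).Y_eq hl, hJ]; ring

theorem pathHom_rel {p q : PathAlg K L} (h : Rel K L p q) :
    pathHom K ha har p = pathHom K ha har q := by
  cases h with
  | one hn h => exact pathHom_relOne K ha har hn h
  | step t hn h1 h2 h =>
    obtain ⟨t, rfl⟩ : ∃ t', t = t' + 1 := ⟨t - 1, by omega⟩
    exact pathHom_relStep K ha har hn h2 h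

/-- The representation of the reconstruction algebra by matrices over `K[x, y]`. -/
def toMatrix : A K r a →ₐ[K] Mat :=
  RingQuot.liftAlgHom K ⟨pathHom K ha har, fun _ _ h => pathHom_rel K ha har h⟩

theorem toMatrix_proj (f : PathAlg K L) : toMatrix K ha har (proj K L f) = pathHom K ha har f :=
  RingQuot.liftAlgHom_mkAlgHom_apply ..

theorem A_induction {P : A K r a → Prop} (h0 : P 0) (hadd : ∀ f g, P f → P g → P (f + g))
    (hpath : ∀ (c : K) (i j : Vertex L) (w : Quiver.Path i j),
      P (c • proj K L (PathAlgebra.ofPath w))) (x : A K r a) : P x := by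
  obtain ⟨f, rfl⟩ := RingQuot.mkAlgHom_surjective K (Rel K L) x
  induction f using PathAlgebra.span_induction with
  | h0 => rwa [map_zero]
  | hadd f g hf hg => rw [map_add]; exact hadd _ _ hf hg
  | hpath c i j w => rw [map_smul]; exact hpath c i j w

open Classical in
/-- The element of the reconstruction algebra given by a path from `i` to `j` of degree `d`. -/
def pathOfDeg (i j : Vertex L) (d : Fin 2 →₀ ℕ) : A K r a :=
  -- The default `0` is harmless: `ofMatrix` has to invert `toMatrix` only on images of paths, where
  -- a word exists.
  if h : ∃ x, (D).Word (rep K ha har) j.val i.val (d 0) (d 1) x then h.choose else 0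

/-- A left inverse of `toMatrix`. -/
def ofMatrix : Mat →ₗ[K] A K r a :=
  ∑ i, ∑ j, (MvPolynomial.basisMonomials (Fin 2) K).constr K (pathOfDeg K ha har i j) ∘ₗ
    (Matrix.entryLinearMap K (MvPolynomial (Fin 2) K) i j)

theorem ofMatrix_single (i j : Vertex L) (d : Fin 2 →₀ ℕ) :
    ofMatrix K ha har (Matrix.single i j (MvPolynomial.monomial d 1)) = pathOfDeg K ha har i j d := by
  have h : ∀ i' j', (MvPolynomial.basisMonomials (Fin 2) K).constr K (pathOfDeg K ha har i' j')
      (Matrix.single i j (MvPolynomial.monomial d 1) i' j') =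
      if i = i' ∧ j = j' then pathOfDeg K ha har i j d else 0 := by
    intro i' j'
    rw [Matrix.single_apply]
    split_ifs with h
    · obtain ⟨rfl, rfl⟩ := h
      rw [show MvPolynomial.monomial d 1 = MvPolynomial.basisMonomials (Fin 2) K d from
        (congrFun (MvPolynomial.coe_basisMonomials ..) d).symm, Module.Basis.constr_basis]
    · rw [map_zero]
  simp only [ofMatrix, LinearMap.sum_apply, LinearMap.comp_apply, Matrix.entryLinearMap_apply, h]
  rw [Finset.sum_eq_single i (fun i' _ hi => Finset.sum_eq_zero fun j' _ => if_neg
    fun h => hi h.1.symm) (by simp), Finset.sum_eq_single j (fun j' _ hj => if_neg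
    fun h => hj h.2.symm) (by simp), if_pos ⟨rfl, rfl⟩]

/-- By `Word.unique`, the word chosen for the ends and degree of a path is the path itself. -/
theorem ofMatrix_toMatrix (x : A K r a) : ofMatrix K ha har (toMatrix K ha har x) = x := by
  induction x using A_induction with
  | h0 => simp only [map_zero]
  | hadd f g hf hg => rw [map_add, map_add, hf, hg]
  | hpath c i j w =>
    have hw := word_ofPath K ha har w
    have hnn := hw.nonneg
    rw [map_smul, map_smul, toMatrix_proj, (isMon_ofPath K ha har w).3, ofMatrix_single]
    have hw' : (D).Word (rep K ha har) j.val i.val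
        (expo (pathDeg ha har w).1 (pathDeg ha har w).2 0)
        (expo (pathDeg ha har w).1 (pathDeg ha har w).2 1) (proj K L (PathAlgebra.ofPath w)) := by
      rwa [expo_apply_zero hnn.1, expo_apply_one _ hnn.2]
    have hex : ∃ x, (D).Word (rep K ha har) j.val i.val
        (expo (pathDeg ha har w).1 (pathDeg ha har w).2 0)
        (expo (pathDeg ha har w).1 (pathDeg ha har w).2 1) x := ⟨_, hw'⟩
    rw [pathOfDeg, dif_pos hex]
    exact congrArg _ (hex.choose_spec.unique i.val_le hw')

theorem toMatrix_injective : Function.Injective (toMatrix K ha har) :=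
  Function.LeftInverse.injective (ofMatrix_toMatrix K ha har)

/-! ### The image of the representation -/

theorem isMon_toMatrix {i j : ℕ} {p q : ℤ} {x : A K r a}
    (h : (D).Word (rep K ha har) j i p q x) :
    IsMon (Vertex.mk L i) (Vertex.mk L j) p q (toMatrix K ha har x) := by
  induction h with
  | nil =>
    have := isMon_ofPath K ha har (Quiver.Path.nil : Quiver.Path (Vertex.mk L j) (Vertex.mk L j))
    rw [← toMatrix_proj] at this
    exact this
  | c₀ h ih =>
    have := isMon_c_zero K ha har
    rw [← c_length_succ, ← toMatrix_proj] at this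
    rw [map_mul]
    exact (this.mul ih).congr (add_comm _ _) (zero_add _)
  | c h1 h2 h ih =>
    have := isMon_c_succ K ha har h2.le
    rw [← toMatrix_proj] at this
    rw [map_mul]
    exact (this.mul ih).congr (add_comm _ _) (zero_add _)
  | a h1 h ih =>
    have := isMon_a K ha har h1.le (Or.inl h1)
    rw [← toMatrix_proj] at this
    rw [map_mul]
    exact (this.mul ih).congr (zero_add _) (add_comm _ _)
  | k hs h ih =>
    have := isMon_outArrow K ha har hs
    rw [← toMatrix_proj] at this
    rw [map_mul]
    exact (this.mul ih).congr (add_comm _ _) (add_comm _ _)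

theorem dvd_of_mem_support_toMatrix (x : A K r a) (i : Vertex L) {d : Fin 2 →₀ ℕ}
    (hd : d ∈ (toMatrix K ha har x i i).support) : r ∣ d 0 + a * d 1 := by
  classical
  induction x using A_induction with
  | h0 => simp at hd
  | hadd f g hf hg =>
    rw [map_add, Matrix.add_apply] at hd
    rcases Finset.mem_union.1 (MvPolynomial.support_add hd) with h | h
    · exact hf h
    · exact hg h
  | hpath c i' j w =>
    rw [map_smul, Matrix.smul_apply] at hd
    have hd' := MvPolynomial.support_smul hd
    rw [toMatrix_proj, (isMon_ofPath K ha har w).3, Matrix.single_apply] at hd'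
    split_ifs at hd' with h
    · obtain ⟨rfl, rfl⟩ := h
      have hw := word_ofPath K ha har w
      have hnn := hw.nonneg
      have hdvd := hw.dvd
      have hd'' := Finset.mem_singleton.1 (MvPolynomial.support_monomial_subset hd')
      have h0 := expo_apply_zero hnn.1 (pathDeg ha har w).2
      have h1 := expo_apply_one (pathDeg ha har w).1 hnn.2
      rw [← hd''] at h0 h1
      rw [← h0, ← h1, ladder_I_zero, ladder_I_one, add_sub_cancel_right] at hdvd
      exact_mod_cast hdvd
    · simp at hd'

/-- The preimage is the sum over all vertices of a cycle of degree `d`. -/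
theorem exists_toMatrix_eq_scalar_monomial (hra : Nat.Coprime r a) {d : Fin 2 →₀ ℕ}
    (hd : r ∣ d 0 + a * d 1) :
    ∃ x, toMatrix K ha har x = Matrix.scalar (Vertex L) (MvPolynomial.monomial d 1) := by
  have hcop : IsCoprime ((D).I 0) ((D).I 1) := by
    rw [ladder_I_zero, ladder_I_one]
    exact Nat.isCoprime_iff_coprime.2 hra
  have h : ∀ i : Vertex L, ∃ x, toMatrix K ha har x =
      Matrix.single i i (MvPolynomial.monomial d 1) := by
    intro i
    obtain ⟨x, hx⟩ := Ladder.Word.exists_cycle (rep K ha har) hcop (t := i.val) i.val_le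
      (u := d 0) (v := d 1) (by omega) (by omega) (by
        rw [ladder_I_zero, ladder_I_one]
        exact_mod_cast hd)
    have := (isMon_toMatrix K ha har hx).3
    rw [Vertex.mk_val, expo_natCast] at this
    exact ⟨x, this⟩
  choose x hx using h
  refine ⟨∑ i, x i, ?_⟩
  rw [map_sum]
  simp only [hx]
  rw [Matrix.sum_single_eq_diagonal]
  rfl

end

/-! ### The standard polynomial identity -/

/-- The standard polynomial of degree `d`. -/
def standardPolynomial (d : ℕ) : MonoidAlgebra ℤ (FreeMonoid ℕ) :=
  ∑ σ : Equiv.Perm (Fin d),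
    MonoidAlgebra.single (FreeMonoid.ofList (List.ofFn fun i => (σ i : ℕ))) (Equiv.Perm.sign σ : ℤ)

open Classical in
theorem coeff_standardPolynomial (d : ℕ) (m : FreeMonoid ℕ) :
    (standardPolynomial d).coeff m = ∑ σ : Equiv.Perm (Fin d),
      if FreeMonoid.ofList (List.ofFn fun i => (σ i : ℕ)) = m then (Equiv.Perm.sign σ : ℤ) else 0 := by
  rw [standardPolynomial, MonoidAlgebra.coeff_sum, Finsupp.finsetSum_apply]
  simp only [MonoidAlgebra.coeff_single, Finsupp.single_apply]

theorem lift_standardPolynomial {R : Type*} [Ring R] [Algebra ℤ R] (d : ℕ) (φ : ℕ → R) :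
    MonoidAlgebra.lift ℤ R (FreeMonoid ℕ) (FreeMonoid.lift φ) (standardPolynomial d) =
      ∑ σ : Equiv.Perm (Fin d), ((Equiv.Perm.sign σ : ℤ) : R) *
        (List.ofFn fun i => φ (σ i : ℕ)).prod := by
  rw [standardPolynomial, map_sum]
  refine Finset.sum_congr rfl fun σ _ => ?_
  rw [MonoidAlgebra.lift_single, FreeMonoid.lift_ofList, List.map_ofFn, Algebra.smul_def,
    eq_intCast]
  rfl

/-- The standard polynomial is the alternatization of the product, so it vanishes on linearly
dependent families; the matrices form a free module of rank `card V * card V`, one less than the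
number of arguments. -/
theorem lift_standardPolynomial_matrix {S V : Type*} [CommRing S] [IsDomain S] [Fintype V]
    [DecidableEq V] (φ : ℕ → Matrix V V S) :
    MonoidAlgebra.lift ℤ (Matrix V V S) (FreeMonoid ℕ) (FreeMonoid.lift φ)
      (standardPolynomial (Fintype.card V * Fintype.card V + 1)) = 0 := by
  rw [lift_standardPolynomial]
  set d := Fintype.card V * Fintype.card V + 1 with hd
  have h : MultilinearMap.alternatization (MultilinearMap.mkPiAlgebraFin S d (Matrix V V S))
      (fun i => φ i) = 0 := by
    refine AlternatingMap.map_linearDependent _ _ fun hli => ?_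
    have := hli.fintype_card_le_finrank
    rw [Module.finrank_matrix, Module.finrank_self, mul_one, Fintype.card_fin] at this
    omega
  rw [MultilinearMap.alternatization_apply] at h
  refine (Finset.sum_congr rfl fun σ _ => ?_).trans h
  rw [Units.smul_def, zsmul_eq_mul, MultilinearMap.domDomCongr_apply,
    MultilinearMap.mkPiAlgebraFin_apply]

theorem isPIRing_of_injective {R S V : Type*} [Ring R] [CommRing S] [IsDomain S] [Fintype V]
    [DecidableEq V] (ψ : R →+* Matrix V V S) (hψ : Function.Injective ψ) : IsPIRing R := by
  classical
  refine ⟨standardPolynomial (Fintype.card V * Fintype.card V + 1),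
    ⟨FreeMonoid.ofList (List.ofFn fun i : Fin (Fintype.card V * Fintype.card V + 1) => (i : ℕ)),
      ?_, fun m hm => ?_⟩, fun φ => hψ ?_⟩
  · rw [coeff_standardPolynomial, Finset.sum_eq_single 1]
    · simp
    · intro σ _ hσ
      rw [if_neg]
      intro h
      refine hσ (Equiv.ext fun i => Fin.ext ?_)
      exact congrFun (List.ofFn_injective (FreeMonoid.ofList.injective h)) i
    · simp
  · rw [coeff_standardPolynomial] at hm
    obtain ⟨σ, -, hσ⟩ := Finset.exists_ne_zero_of_sum_ne_zero hm
    have h := (ite_ne_right_iff.1 hσ).1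
    rw [← h]
    show (List.ofFn _).length ≤ (List.ofFn _).length
    rw [List.length_ofFn, List.length_ofFn]
  · rw [map_zero, ← lift_standardPolynomial_matrix fun i => ψ (φ i), lift_standardPolynomial,
      lift_standardPolynomial, map_sum]
    refine Finset.sum_congr rfl fun σ _ => ?_
    rw [map_mul, map_intCast, map_list_prod, List.map_ofFn]
    rfl

/-! ### The invariant ring -/

section

variable {K : Type u} [Field K]

theorem linearSubst_monomial {g : GL (Fin 2) K} {w : Fin 2 → K}
    (hg : (g : Matrix (Fin 2) (Fin 2) K) = Matrix.diagonal w) (d : Fin 2 →₀ ℕ) (t : K) :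
    linearSubst g (MvPolynomial.monomial d t) =
      MvPolynomial.monomial d ((w 0 ^ d 0 * w 1 ^ d 1) * t) := by
  have hX : ∀ j, linearSubst g (MvPolynomial.X j) = MvPolynomial.C (w j) * MvPolynomial.X j := by
    intro j
    have : ∀ i, (g : Matrix (Fin 2) (Fin 2) K) i j = Matrix.diagonal w i j := fun i => by rw [hg]
    rw [linearSubst, MvPolynomial.aeval_X]
    simp only [this]
    rw [Finset.sum_eq_single j (fun i _ hi => by rw [Matrix.diagonal_apply_ne _ hi]; simp)
      (by simp), Matrix.diagonal_apply_eq]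
  rw [MvPolynomial.monomial_eq, MvPolynomial.monomial_eq, Finsupp.prod_fintype _ _ (by simp),
    Fin.prod_univ_two, map_mul, map_mul, map_pow, map_pow, hX, hX, ← MvPolynomial.algebraMap_eq,
    AlgHom.commutes]
  simp only [MvPolynomial.algebraMap_eq, map_mul, map_pow]
  ring

theorem coeff_linearSubst {g : GL (Fin 2) K} {w : Fin 2 → K}
    (hg : (g : Matrix (Fin 2) (Fin 2) K) = Matrix.diagonal w) (f : MvPolynomial (Fin 2) K)
    (d : Fin 2 →₀ ℕ) :
    (linearSubst g f).coeff d = (w 0 ^ d 0 * w 1 ^ d 1) * f.coeff d := by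
  induction f using MvPolynomial.monomial_add_induction_on with
  | C t =>
    rw [← MvPolynomial.monomial_zero', linearSubst_monomial hg, MvPolynomial.coeff_monomial,
      MvPolynomial.coeff_monomial]
    split_ifs with h
    · rw [h]
    · rw [mul_zero]
  | monomial_add e t f he ht ih =>
    rw [map_add, MvPolynomial.coeff_add, MvPolynomial.coeff_add, ih, linearSubst_monomial hg,
      MvPolynomial.coeff_monomial, MvPolynomial.coeff_monomial, mul_add]
    split_ifs with h
    · rw [h]
    · rw [mul_zero]

/-- The generator multiplies `x ^ i * y ^ j` by `ε ^ (i + a * j)`, and powers of the generator have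
the same shape with `ε` replaced by another `r`-th root of unity. -/
theorem mem_invariantRing_iff {r a : ℕ} {ε : Kˣ} (hε : IsPrimitiveRoot ε r)
    {f : MvPolynomial (Fin 2) K} :
    f ∈ invariantRing (cyclicGroup ε a) ↔ ∀ d ∈ f.support, r ∣ d 0 + a * d 1 := by
  set ψ : (Fin 2 → Kˣ) →* GL (Fin 2) K :=
    (Units.map (Matrix.diagonalRingHom (Fin 2) K).toMonoidHom).comp
      (MulEquiv.piUnits (M := fun _ : Fin 2 => K)).symm.toMonoidHom with hψ
  have hψv : ∀ w, (ψ w : Matrix (Fin 2) (Fin 2) K) = Matrix.diagonal fun i => (w i : K) :=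
    fun w => rfl
  have hgen : cyclicGroup ε a = Subgroup.zpowers (ψ ![ε, ε ^ a]) := rfl
  rw [invariantRing, Algebra.mem_iInf]
  have hpow : ∀ (η : Kˣ) (d : Fin 2 →₀ ℕ), ((η : K) ^ d 0 * ((η ^ a : Kˣ) : K) ^ d 1) =
      ((η ^ (d 0 + a * d 1) : Kˣ) : K) := by
    intro η d
    push_cast
    rw [pow_add, pow_mul]
  constructor
  · intro h d hd
    have h1 : linearSubst (ψ ![ε, ε ^ a]) f = f :=
      h ⟨_, by rw [hgen]; exact Subgroup.mem_zpowers _⟩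
    have h2 := coeff_linearSubst (hψv ![ε, ε ^ a]) f d
    rw [h1] at h2
    have h3 : ((ε : K) ^ d 0 * ((ε ^ a : Kˣ) : K) ^ d 1) = 1 :=
      mul_right_cancel₀ (MvPolynomial.mem_support_iff.1 hd) ((one_mul _).trans h2).symm
    rw [hpow] at h3
    exact hε.dvd_of_pow_eq_one _ (Units.ext h3)
  · rintro h ⟨g, hg⟩
    rw [hgen] at hg
    obtain ⟨m, rfl⟩ := Subgroup.mem_zpowers_iff.1 hg
    show linearSubst (ψ ![ε, ε ^ a] ^ m) f = f
    rw [← map_zpow]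
    ext d
    rw [coeff_linearSubst (hψv _)]
    by_cases hd : d ∈ f.support
    · have h1 : ((![ε, ε ^ a] : Fin 2 → Kˣ) ^ m) 1 = (((![ε, ε ^ a] : Fin 2 → Kˣ) ^ m) 0) ^ a := by
        simp only [Pi.pow_apply, Matrix.cons_val_one, Matrix.cons_val_zero]
        rw [← zpow_natCast, ← zpow_natCast, ← zpow_mul, ← zpow_mul, mul_comm]
      rw [h1, hpow]
      obtain ⟨e, he⟩ := h d hd
      have h2 : (((![ε, ε ^ a] : Fin 2 → Kˣ) ^ m) 0) ^ (d 0 + a * d 1) = 1 := by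
        rw [he, pow_mul]
        have : (((![ε, ε ^ a] : Fin 2 → Kˣ) ^ m) 0) ^ r = 1 := by
          simp only [Pi.pow_apply, Matrix.cons_val_zero]
          rw [← zpow_natCast, ← zpow_mul, mul_comm, zpow_mul, zpow_natCast, hε.pow_eq_one, one_zpow]
        rw [this, one_pow]
      rw [h2, Units.val_one, one_mul]
    · rw [MvPolynomial.notMem_support_iff.1 hd, mul_zero]

/-- The invariants contain `x ^ r` and `y ^ r`, so `K[x, y]` is integral over them; it is also of
finite type. -/
theorem finite_invariantRing {r a : ℕ} (hr : 0 < r) {ε : Kˣ} (hε : IsPrimitiveRoot ε r) :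
    Module.Finite (invariantRing (cyclicGroup ε a)) (MvPolynomial (Fin 2) K) := by
  have hX : ∀ i, (MvPolynomial.X i : MvPolynomial (Fin 2) K) ^ r ∈
      invariantRing (cyclicGroup ε a) := by
    intro i
    rw [mem_invariantRing_iff hε, MvPolynomial.X_pow_eq_monomial]
    intro d hd
    obtain rfl := Finset.mem_singleton.1 (MvPolynomial.support_monomial_subset hd)
    fin_cases i <;> simp
  have hint : Algebra.IsIntegral (invariantRing (cyclicGroup ε a)) (MvPolynomial (Fin 2) K) := by
    refine ⟨fun f => ?_⟩
    induction f using MvPolynomial.induction_on with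
    | C t => exact isIntegral_algebraMap (x := algebraMap K (invariantRing (cyclicGroup ε a)) t)
    | add f g hf hg => exact hf.add hg
    | mul_X f i hf =>
      refine hf.mul (IsIntegral.of_pow hr ?_)
      exact isIntegral_algebraMap
        (x := (⟨MvPolynomial.X i ^ r, hX i⟩ : invariantRing (cyclicGroup ε a)))
  have : Algebra.FiniteType (invariantRing (cyclicGroup ε a)) (MvPolynomial (Fin 2) K) :=
    Algebra.FiniteType.of_restrictScalars_finiteType K _ _
  exact Algebra.IsIntegral.finite

/-- The Artin–Tate lemma makes the invariant ring a finitely generated `K`-algebra. -/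
theorem isNoetherianRing_invariantRing {r a : ℕ} (hr : 0 < r) {ε : Kˣ}
    (hε : IsPrimitiveRoot ε r) : IsNoetherianRing (invariantRing (cyclicGroup ε a)) := by
  have := finite_invariantRing (a := a) hr hε
  have h := fg_of_fg_of_fg K (invariantRing (cyclicGroup ε a)) (MvPolynomial (Fin 2) K)
    Algebra.FiniteType.out Module.Finite.fg_top Subtype.val_injective
  have : Algebra.FiniteType K (invariantRing (cyclicGroup ε a)) := ⟨h⟩
  exact Algebra.FiniteType.isNoetherianRing K _

end

/-! ### The centre -/

section

variable {K : Type u} [Field K] {r a : ℕ} (ha : 0 < a) (har : a < r)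

local notation "L" => jungHirzebruch r a

local notation "D" => ladder r a ha har

theorem scalarAlgHom_eq_diagonal {V : Type*} [Fintype V] [DecidableEq V]
    (f : MvPolynomial (Fin 2) K) :
    Matrix.scalarAlgHom V K f = Matrix.diagonal fun _ => f := rfl

theorem exists_toMatrix_eq_scalar (hra : Nat.Coprime r a) {ε : Kˣ} (hε : IsPrimitiveRoot ε r)
    {f : MvPolynomial (Fin 2) K} (hf : f ∈ invariantRing (cyclicGroup ε a)) :
    ∃ x, toMatrix K ha har x = Matrix.scalarAlgHom (Vertex L) K f := by
  rw [mem_invariantRing_iff hε] at hf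
  rw [← f.support_sum_monomial_coeff, map_sum]
  have h : ∀ d ∈ f.support, ∃ x, toMatrix K ha har x =
      Matrix.scalarAlgHom (Vertex L) K (MvPolynomial.monomial d (f.coeff d)) := by
    intro d hd
    obtain ⟨x, hx⟩ := exists_toMatrix_eq_scalar_monomial K ha har hra (hf d hd)
    refine ⟨f.coeff d • x, ?_⟩
    rw [map_smul, hx, ← mul_one (f.coeff d), ← smul_eq_mul, ← MvPolynomial.smul_monomial, map_smul,
      smul_eq_mul, mul_one]
    rfl
  choose! x hx using h
  exact ⟨∑ d ∈ f.support, x d, by rw [map_sum]; exact Finset.sum_congr rfl hx⟩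

/-- Commuting with the trivial paths kills the off-diagonal entries. Commuting with `A_{0i}`, whose
matrix is one nonzero monomial at `(0, i)`, equates the diagonal entries at `0` and `i` after
cancelling the monomial. -/
theorem toMatrix_eq_scalar_of_mem_center {z : A K r a} (hz : z ∈ Subalgebra.center K (A K r a)) :
    toMatrix K ha har z =
      Matrix.scalarAlgHom (Vertex L) K (toMatrix K ha har z (Vertex.mk L 0) (Vertex.mk L 0)) := by
  rw [Subalgebra.mem_center_iff] at hz
  have hcomm : ∀ x, toMatrix K ha har x * toMatrix K ha har z =
      toMatrix K ha har z * toMatrix K ha har x := fun x => by rw [← map_mul, hz, map_mul]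
  have key : ∀ i : Vertex L, ∀ m : MvPolynomial (Fin 2) K, ∀ i' : Vertex L, ∀ x,
      toMatrix K ha har x = Matrix.single i' i m → ∀ j,
      (if j = i' then m * toMatrix K ha har z i i else 0) = toMatrix K ha har z j i' * m := by
    intro i m i' x hx j
    have h := congrFun (congrFun (hcomm x) j) i
    rw [hx, Matrix.mul_single_apply_same] at h
    rw [← h]
    split_ifs with hj
    · rw [hj, Matrix.single_mul_apply_same]
    · rw [Matrix.single_mul_apply_of_ne _ _ _ _ _ hj]
  ext1 i j
  rw [scalarAlgHom_eq_diagonal, Matrix.diagonal_apply]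
  split_ifs with h
  · subst h
    rcases Nat.eq_zero_or_pos i.val with h0 | h0
    · rw [← i.mk_val, h0]
    · have hw := (Ladder.Word.nil (ρ := rep K ha har) (j := i.val)).A_mul i.val_le
      have hm := (isMon_toMatrix K ha har hw).3
      rw [i.mk_val] at hm
      have h1 := key _ _ _ _ hm (Vertex.mk L 0)
      rw [if_pos rfl, mul_comm] at h1
      exact mul_right_cancel₀ (by simp) h1
  · have h1 := key j 1 j _ ((isMon_ofPath K ha har (.nil : Quiver.Path j j)).eq
      (IsMon.one_single j) rfl rfl ▸ toMatrix_proj K ha har _) i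
    rw [if_neg h, mul_one] at h1
    exact h1.symm

/-- The invariant ring is embedded in the centre of the reconstruction algebra. -/
theorem exists_invariantRing_equiv_center (hra : Nat.Coprime r a) {ε : Kˣ}
    (hε : IsPrimitiveRoot ε r) :
    ∃ e : invariantRing (cyclicGroup ε a) ≃ₐ[K] Subalgebra.center K (A K r a),
      ∀ f, toMatrix K ha har (e f) = Matrix.scalarAlgHom (Vertex L) K f.1 := by
  have hinj := toMatrix_injective K ha har
  let s : invariantRing (cyclicGroup ε a) →ₐ[K] (toMatrix K ha har).range :=
    ((Matrix.scalarAlgHom (Vertex L) K).comp (invariantRing (cyclicGroup ε a)).val).codRestrict _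
      fun f => exists_toMatrix_eq_scalar ha har hra hε f.2
  let t : invariantRing (cyclicGroup ε a) →ₐ[K] A K r a :=
    (AlgEquiv.ofInjective (toMatrix K ha har) hinj).symm.toAlgHom.comp s
  have ht : ∀ f, toMatrix K ha har (t f) = Matrix.scalarAlgHom (Vertex L) K f.1 := fun f =>
    congrArg Subtype.val ((AlgEquiv.ofInjective (toMatrix K ha har) hinj).apply_symm_apply (s f))
  let t' : invariantRing (cyclicGroup ε a) →ₐ[K] Subalgebra.center K (A K r a) :=
    t.codRestrict _ fun f => by
      rw [Subalgebra.mem_center_iff]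
      intro b
      refine hinj ?_
      rw [map_mul, map_mul, ht]
      exact (Matrix.scalar_commute f.1 (fun _ => mul_comm _ _) _).symm
  have ht' : ∀ f, toMatrix K ha har (t' f) = Matrix.scalarAlgHom (Vertex L) K f.1 := ht
  refine ⟨AlgEquiv.ofBijective t' ⟨fun f g hfg => ?_, fun z => ?_⟩, ht'⟩
  · have h := ht' f
    rw [hfg, ht'] at h
    have h0 := congrFun (congrFun h (Vertex.mk L 0)) (Vertex.mk L 0)
    simp only [scalarAlgHom_eq_diagonal, Matrix.diagonal_apply_eq] at h0
    exact Subtype.ext h0.symm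
  · have hz := toMatrix_eq_scalar_of_mem_center ha har z.2
    refine ⟨⟨_, (mem_invariantRing_iff hε).2 fun d hd =>
      dvd_of_mem_support_toMatrix K ha har z.1 (Vertex.mk L 0) hd⟩, Subtype.ext (hinj ?_)⟩
    exact (ht' _).trans hz.symm

/-- Over the invariant ring, `toMatrix` is a linear embedding into finitely many copies of `K[x,
y]`, a noetherian module. -/
theorem isNoetherian_of_algHom {ε : Kˣ} (hε : IsPrimitiveRoot ε r)
    [Algebra (invariantRing (cyclicGroup ε a)) (A K r a)]
    (h : ∀ f, toMatrix K ha har (algebraMap (invariantRing (cyclicGroup ε a)) (A K r a) f) =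
      Matrix.scalarAlgHom (Vertex L) K f.1) :
    IsNoetherian (invariantRing (cyclicGroup ε a)) (A K r a) := by
  have := finite_invariantRing (a := a) (by omega) hε
  have := isNoetherianRing_invariantRing (a := a) (by omega) hε
  let φ : A K r a →ₗ[invariantRing (cyclicGroup ε a)]
      Matrix (Vertex L) (Vertex L) (MvPolynomial (Fin 2) K) :=
    { toFun := toMatrix K ha har
      map_add' := map_add _
      map_smul' := fun f x => by
        rw [Algebra.smul_def, map_mul, h, scalarAlgHom_eq_diagonal,
          ← Matrix.smul_eq_diagonal_mul]
        rfl }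
  have hS : IsNoetherian (invariantRing (cyclicGroup ε a)) (MvPolynomial (Fin 2) K) :=
    isNoetherian_of_isNoetherianRing_of_finite _ _
  have : IsNoetherian (invariantRing (cyclicGroup ε a))
      (Matrix (Vertex L) (Vertex L) (MvPolynomial (Fin 2) K)) :=
    inferInstanceAs (IsNoetherian _ (Vertex L → Vertex L → MvPolynomial (Fin 2) K))
  exact isNoetherian_of_injective φ (toMatrix_injective K ha har)

end

end Reconstruction

end

/-! ### The main theorem -/

theorem mainTheorem4 (K : Type*) [Field K] [IsAlgClosed K] [CharZero K]
    (r a : ℕ) (ha : 0 < a) (har : a < r) (hra : Nat.Coprime r a)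
    (ε : Kˣ) (hε : IsPrimitiveRoot ε r) :
    Nonempty (Subalgebra.center K (Reconstruction.A K r a) ≃ₐ[K]
      Reconstruction.invariantRing (Reconstruction.cyclicGroup ε a)) ∧
    Module.Finite (Subalgebra.center K (Reconstruction.A K r a)) (Reconstruction.A K r a) ∧
    IsNoetherianRing (Reconstruction.A K r a) ∧
    IsNoetherianRing (Reconstruction.A K r a)ᵐᵒᵖ ∧
    Reconstruction.IsPIRing (Reconstruction.A K r a) := by
  obtain ⟨e, he⟩ := Reconstruction.exists_invariantRing_equiv_center ha har hra hε
  let _ : Algebra (Reconstruction.invariantRing (Reconstruction.cyclicGroup ε a))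
      (Reconstruction.A K r a) :=
    ((Subalgebra.center K (Reconstruction.A K r a)).val.toRingHom.comp
      e.toAlgHom.toRingHom).toAlgebra' fun f x =>
        (Subalgebra.mem_center_iff.1 (e f).2 x).symm
  have hN := Reconstruction.isNoetherian_of_algHom ha har hε he
  refine ⟨⟨e.symm⟩, ?_, isNoetherian_of_tower _ hN, ?_,
    Reconstruction.isPIRing_of_injective (Reconstruction.toMatrix K ha har).toRingHom
      (Reconstruction.toMatrix_injective K ha har)⟩
  -- Generators over the invariant ring also generate over the centre, since the invariants act
  -- through `e`.
  · obtain ⟨s, hs⟩ := hN.noetherian ⊤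
    refine ⟨⟨s, eq_top_iff.2 fun x _ => ?_⟩⟩
    have hx : x ∈ Submodule.span _ (s : Set (Reconstruction.A K r a)) := hs ▸ Submodule.mem_top
    induction hx using Submodule.span_induction with
    | mem x hx => exact Submodule.subset_span hx
    | zero => exact Submodule.zero_mem _
    | add x y _ _ hx hy => exact Submodule.add_mem _ (hx trivial) (hy trivial)
    | smul f x _ hx => exact Submodule.smul_mem _ (e f) (hx trivial)
  -- The scalars are central, so the opposite ring is the same module over the invariants.
  · have : IsNoetherian (Reconstruction.invariantRing (Reconstruction.cyclicGroup ε a))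
        (Reconstruction.A K r a)ᵐᵒᵖ :=
      isNoetherian_of_linearEquiv (MulOpposite.opLinearEquiv _)
    exact isNoetherian_of_tower _ this
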